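/- Let $R\subset\mathbb R^d$ be a root system with reflection group $G$, $k:R\to[0,\infty)$ a $G$-invariant multiplicity function, $a>0$, $\langle k\rangle=\frac12\sum_{\alpha\in R}k(\alpha)$, $\lambda_k=\frac d2-1+\langle k\rangle$, and $$d\mu_{k,a}(x)=c_{k,a}|x|^{a-2}\prod_{\alpha\in R}|\langle\alpha,x\rangle|^{k(\alpha)}\,dx,\qquad \int_{\mathbb R^d}e^{-|x|^a/a}\,d\mu_{k,a}(x)=1 .$$ The $(k,a)$-generalized Fourier transform is the unitary operator on $L^2(\mathbb R^d,d\mu_{k,a})$ $$\mathcal F_{k,a}=\exp\Bigl(\tfrac{i\pi}{2a}(2\lambda_k+a)\Bigr)\exp\Bigl(\tfrac{i\pi}{2a}\bigl(|x|^{2-a}\Delta_k-|x|^a\bigr)\Bigr),$$ where $\Delta_k$ is the Dunkl Laplacian. It acts diagonally on the functions $h(x)\,L_s^{(2(\lambda_k+n)/a)}\bigl(\tfrac2a|x|^a\bigr)e^{-|x|^a/a}$ ($n,s\ge 0$, $h$ a homogeneous polynomial of degree $n$ with $\Delta_kh=0$, $L_s^{(\nu)}$ the Laguerre polynomials), which are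 eigenfunctions of $|x|^{2-a}\Delta_k-|x|^a$. Its kernel $B_{k,a}$ is the continuous function with $\mathcal F_{k,a}(f)(y)=\int B_{k,a}(y,x)f(x)\,d\mu_{k,a}(x)$ for a.e. $y$, for every continuous compactly supported $f$. **Proposition.** Under the condition $2\langle k\rangle+d+a>2$, the inequality $$|B_{k,a}(x,y)|\le B_{k,a}(0,y)=1\qquad(x,y\in\mathbb R^d)$$ is not true in general. Indeed, let $d=1$, $R=\{1,-1\}$, with constant multiplicity $k=\langle k\rangle>0$, and $a=1$ (so that the condition holds). 1. If $0<k<\frac14$, then the kernel $B_{k,1}$ exists and is unique, $B_{k,1}(0,y)=1$ for all $y$, and $B_{k,1}$ is unbounded on $\{(x,y):xy>0\}$. 2. If $k=\frac14$, then the kernel $B_{1/4,1}$ exists and is unique, $B_{1/4,1}(0,y)=1$ for all $y$, $$B_{1/4,1}(x,y)=2\cos t-\frac{\sin t}{t},\qquad t=2|xy|^{1/2},\quad xy>0,$$ and $\max_{x,y\in\mathbb R}|B_{1/4,1}(x,y)|$ is attained and equals $2.03$ up to an error less than $0.005$; in particular it exceeds $1$. -/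

import Mathlib

open MeasureTheory

noncomputable section

namespace KAFourier

/-- A reduced root system on a finite-dimensional Euclidean space `E`, together with a nonnegative
multiplicity function that is invariant under the reflections in the roots (hence under the finite
reflection group that they generate). -/
structure DunklDatum (E : Type*) [NormedAddCommGroup E] [InnerProductSpace ℝ E]
    [FiniteDimensional ℝ E] where
  /-- the root system `R`, positive and negative roots together -/
  roots : Finset E
  root_ne_zero : ∀ α ∈ roots, α ≠ 0
  reflection_mem : ∀ α ∈ roots, ∀ β ∈ roots, (Submodule.span ℝ {α})ᗮ.reflection β ∈ roots
  reduced : ∀ α ∈ roots, ∀ c : ℝ, c • α ∈ roots → c = 1 ∨ c = -1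
  /-- the multiplicity function `k`; only its values on the roots matter -/
  mult : E → ℝ
  mult_nonneg : ∀ α ∈ roots, 0 ≤ mult α
  mult_reflection : ∀ α ∈ roots, ∀ β ∈ roots,
    mult ((Submodule.span ℝ {α})ᗮ.reflection β) = mult β

section General

variable {E : Type*} [NormedAddCommGroup E] [InnerProductSpace ℝ E] [FiniteDimensional ℝ E]

/-- `⟨k⟩`, half the sum of the multiplicities over all roots. -/
def DunklDatum.index (D : DunklDatum E) : ℝ := (1 / 2) * ∑ α ∈ D.roots, D.mult α

/-- `λ_k = d / 2 - 1 + ⟨k⟩`. -/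
def DunklDatum.lam (D : DunklDatum E) : ℝ := (Module.finrank ℝ E : ℝ) / 2 - 1 + D.index

/-- Points off the origin and off all reflecting hyperplanes (an open dense set, stable under the
reflections). The operators below are only ever evaluated at such points. -/
def DunklDatum.Regular (D : DunklDatum E) (x : E) : Prop :=
  x ≠ 0 ∧ ∀ α ∈ D.roots, inner ℝ α x ≠ 0

/-- The Dunkl operator in the direction `ξ`. The sum over the positive roots is written as half
the sum over all roots (the summands of `α` and `-α` agree). -/
def DunklDatum.dunklOp (D : DunklDatum E) (ξ : E) (f : E → ℂ) (x : E) : ℂ :=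
  fderiv ℝ f x ξ + (1 / 2) * ∑ α ∈ D.roots, ((D.mult α * inner ℝ α ξ : ℝ) : ℂ) *
    ((f x - f ((Submodule.span ℝ {α})ᗮ.reflection x)) / ((inner ℝ α x : ℝ) : ℂ))

/-- The Dunkl Laplacian `Δ_k = ∑ j, D_j ^ 2`. -/
def DunklDatum.dunklLaplacian (D : DunklDatum E) (f : E → ℂ) (x : E) : ℂ :=
  ∑ i, D.dunklOp (stdOrthonormalBasis ℝ E i) (D.dunklOp (stdOrthonormalBasis ℝ E i) f) x

/-- The `a`-deformed Dunkl harmonic oscillator `Δ_{k,a} = |x|^(2-a) Δ_k - |x|^a`. -/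
def DunklDatum.oscillator (D : DunklDatum E) (a : ℝ) (f : E → ℂ) (x : E) : ℂ :=
  ((‖x‖ ^ (2 - a) : ℝ) : ℂ) * D.dunklLaplacian f x - ((‖x‖ ^ a : ℝ) : ℂ) * f x

/-- `h` is a homogeneous polynomial of degree `n` on `E` (the diagonal of an `n`-linear form)
in the kernel of the Dunkl Laplacian. -/
def DunklDatum.IsHarmonic (D : DunklDatum E) (n : ℕ) (h : E → ℂ) : Prop :=
  (∃ m : MultilinearMap ℝ (fun _ : Fin n => E) ℂ, ∀ x, h x = m (fun _ => x)) ∧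
    ∀ x, D.Regular x → D.dunklLaplacian h x = 0

/-- The Laguerre polynomial `L_s^(ν)(t)`, for `ν > -1`. -/
def laguerre (s : ℕ) (ν t : ℝ) : ℝ :=
  ∑ j ∈ Finset.range (s + 1), (-1) ^ j * Real.Gamma (ν + s + 1) /
    ((s - j).factorial * Real.Gamma (ν + j + 1)) * (t ^ j / j.factorial)

/-- The function `h(x) L_s^(2(λ_k+n)/a)(2|x|^a/a) exp(-|x|^a/a)`. For `h` running through the
`k`-harmonic homogeneous polynomials of degree `n`, these are the eigenfunctions of `Δ_{k,a}` that
span a dense subspace of `L²(μ_{k,a})`. -/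
def DunklDatum.eigenfun (D : DunklDatum E) (a : ℝ) (n s : ℕ) (h : E → ℂ) (x : E) : ℂ :=
  h x * ((laguerre s (2 * (D.lam + n) / a) (2 / a * ‖x‖ ^ a) * Real.exp (-(‖x‖ ^ a / a)) : ℝ) : ℂ)

/-- The weight `v_{k,a}(x) = |x|^(a-2) ∏_{α ∈ R} |⟨α,x⟩|^{k(α)}`. -/
def DunklDatum.weight (D : DunklDatum E) (a : ℝ) (x : E) : ℝ :=
  ‖x‖ ^ (a - 2) * ∏ α ∈ D.roots, |inner ℝ α x| ^ D.mult α

variable [MeasurableSpace E] [BorelSpace E]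

/-- The measure `dμ_{k,a} = c_{k,a} v_{k,a}(x) dx`, where
`c_{k,a}⁻¹ = ∫ exp(-|x|^a/a) v_{k,a}(x) dx`. -/
def DunklDatum.measure (D : DunklDatum E) (a : ℝ) : Measure E :=
  volume.withDensity fun x => ENNReal.ofReal
    ((∫ z : E, Real.exp (-(‖z‖ ^ a / a)) * D.weight a z)⁻¹ * D.weight a x)

/-- `F` is the `(k,a)`-generalized Fourier transform
`exp(iπ(2λ_k+a)/(2a)) exp(iπ/(2a) Δ_{k,a})`, a unitary operator on `L²(μ_{k,a})`: on an
eigenfunction of `Δ_{k,a}` with eigenvalue `c` the second factor acts as `exp(iπc/(2a))`. -/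
def DunklDatum.IsFourierTransform (D : DunklDatum E) (a : ℝ)
    (F : Lp ℂ 2 (D.measure a) ≃ₗᵢ[ℂ] Lp ℂ 2 (D.measure a)) : Prop :=
  ∀ (n s : ℕ) (h : E → ℂ), D.IsHarmonic n h →
    ∀ c : ℂ, (∀ x, D.Regular x →
        D.oscillator a (D.eigenfun a n s h) x = c * D.eigenfun a n s h x) →
      ∀ hL : MemLp (D.eigenfun a n s h) 2 (D.measure a),
        F (hL.toLp (D.eigenfun a n s h)) =
          (Complex.exp (Complex.I * Real.pi / (2 * a) * (2 * D.lam + a)) *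
            Complex.exp (Complex.I * Real.pi / (2 * a) * c)) • hL.toLp (D.eigenfun a n s h)

/-- `B` is the kernel `B_{k,a}` of the `(k,a)`-generalized Fourier transform: it is continuous and
`F_{k,a}(f)(y) = ∫ B(y,x) f(x) dμ_{k,a}(x)` for a.e. `y`, for every continuous compactly
supported `f` (a dense class on which the integral converges absolutely even if `B` is unbounded). -/
def DunklDatum.IsKernel (D : DunklDatum E) (a : ℝ) (B : E → E → ℂ) : Prop :=
  Continuous (fun p : E × E => B p.1 p.2) ∧
    ∃ F : Lp ℂ 2 (D.measure a) ≃ₗᵢ[ℂ] Lp ℂ 2 (D.measure a), D.IsFourierTransform a F ∧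
      ∀ f : E → ℂ, Continuous f → HasCompactSupport f →
        ∃ hL : MemLp f 2 (D.measure a),
          ∀ᵐ y ∂(D.measure a), F (hL.toLp f) y = ∫ x, B y x * f x ∂(D.measure a)

end General

theorem reflection_real (α : ℝ) (hα : α ≠ 0) (x : ℝ) :
    (Submodule.span ℝ {α})ᗮ.reflection x = -x := by
  have hx : x = (x / α) • α := by simp [hα]
  rw [hx, map_smul, Submodule.reflection_orthogonalComplement_singleton_eq_neg, smul_neg]

/-- The one-dimensional case: on the real line, the root system `{1, -1}` with the constant
multiplicity `k ≥ 0`. -/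
def rankOne (k : ℝ) (hk : 0 ≤ k) : DunklDatum ℝ where
  roots := {1, -1}
  root_ne_zero := by simp
  reflection_mem := by
    intro α hα β hβ
    have h0 : α ≠ 0 := by rintro rfl; simp at hα
    rw [reflection_real α h0]
    simp only [Finset.mem_insert, Finset.mem_singleton] at hβ ⊢
    rcases hβ with rfl | rfl <;> simp
  reduced := by
    intro α hα c hc
    simp only [Finset.mem_insert, Finset.mem_singleton, smul_eq_mul] at hα hc
    rcases hα with rfl | rfl <;> rcases hc with h | h
    · left; linarith
    · right; linarith
    · right; linarith
    · left; linarith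
  mult := fun _ => k
  mult_nonneg := fun _ _ => hk
  mult_reflection := fun _ _ _ _ => rfl

end KAFourier

end

/-! On the line with `a = 1` everything is explicit. Write J_β(z) = ∑ (-z)^m / (m! Γ(m+β)), a
rescaled Bessel function. The kernel is B(x,y) = Γ(2k) (J_{2k}(|xy|) - xy J_{2k+2}(|xy|)), which is
`rankOneKernel`, and both parts of the proposition are read off from it.

Identification of the kernel. In rank one the k-harmonic polynomials are the multiples of 1 and x,
so the eigenfunctions are x^n L_s^{(2k-1+2n)}(2|x|) e^{-|x|} with n ≤ 1, and the phases combine to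
the eigenvalue (-1)^(n+s) of the Fourier transform. The Laguerre functions are eigenfunctions of the
Hankel transform (`integral_laguerre_mul_besselClifford`). Applied with ν = 2k-1 to the even part of
the kernel and ν = 2k+1 to the odd part, this shows that the integral transform with kernel B has
the same eigenvalues. The eigenfunctions are complete, since a measure with an exponential moment is
determined by its moments. As the transform is symmetric, any admissible unitary operator agrees
with it on exponentially decaying functions
(`DunklDatum.IsFourierTransform.ae_eq_rankOneTransform`). Such an operator exists: it is the
orthogonal reflection that fixes the closed span of the eigenfunctions with n+s even. Continuity and
the full support of the measure make the kernel unique.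

Unboundedness for β = 2k < 1/2. With U = J_{β+1}, V = J_{β+2} and z = xy > 0, the recurrence turns
the kernel into Γ(β)(βU - 2zV), where U is bounded. A bound on the kernel would bound zV, and then
the energy U² + zV² would be O(1/z), because its derivative is a multiple of V² and it tends to 0.
But the energy has exact order z^{-(β+1/2)} (`exists_besselClifford_energy_bounds`), and β + 1/2 <
1. No Bessel asymptotics are needed.

The case k = 1/4. Here the Bessel functions are elementary: the kernel is 2 cos t - sin t / t for xy
> 0 and sin t / t for xy < 0, with t = 2√|xy|. The first profile has square at most 4 + 1/t², so a
maximum exists on a compact interval, and numerical estimates near t = π locate it. -/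

noncomputable section

namespace KAFourier

/-! ### Bessel–Clifford functions: series, recurrence, energy, half-integer cases. -/

/-- The Bessel–Clifford function `∑ (-z)^m / (m! Γ(m+β))`. -/
def besselClifford (β z : ℝ) : ℝ :=
  ∑' m : ℕ, (-z) ^ m / (m.factorial * Real.Gamma (m + β))

/-- Γ(m+β) is a product of the factors β + i times Γ(β), each factor at least β. This lets the
exponential series dominate the Bessel–Clifford series. -/
theorem pow_mul_Gamma_le {β : ℝ} (hβ : 0 < β) (m : ℕ) :
    β ^ m * Real.Gamma β ≤ Real.Gamma (m + β) := by
  induction m with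
  | zero => simp
  | succ m ih =>
    have h : ((m + 1 : ℕ) : ℝ) + β = (m + β) + 1 := by push_cast; ring
    rw [h, Real.Gamma_add_one (by positivity), pow_succ]
    have : 0 ≤ β ^ m * Real.Gamma β := by
      have := Real.Gamma_pos_of_pos hβ
      positivity
    have hm : (0 : ℝ) ≤ m := m.cast_nonneg
    nlinarith [mul_nonneg hm (this.trans ih)]

theorem summable_besselClifford_abs {β : ℝ} (hβ : 0 < β) (z : ℝ) :
    Summable fun m : ℕ => |z| ^ m / (m.factorial * Real.Gamma (m + β)) := by
  have h := (Real.summable_pow_div_factorial (|z| / β)).mul_left (1 / Real.Gamma β)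
  have hΓ := Real.Gamma_pos_of_pos hβ
  refine h.of_nonneg_of_le (fun m => ?_) fun m => ?_
  · have := Real.Gamma_pos_of_pos (show 0 < (m : ℝ) + β by positivity)
    positivity
  · have h1 := pow_mul_Gamma_le hβ m
    have h2 : 1 / Real.Gamma β * ((|z| / β) ^ m / m.factorial)
        = |z| ^ m / (m.factorial * (β ^ m * Real.Gamma β)) := by
      rw [div_pow]; field_simp
    rw [h2]
    gcongr

theorem summable_besselClifford {β : ℝ} (hβ : 0 < β) (z : ℝ) :
    Summable fun m : ℕ => (-z) ^ m / (m.factorial * Real.Gamma (m + β)) := by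
  refine (summable_besselClifford_abs hβ z).of_norm_bounded fun m => le_of_eq ?_
  have := Real.Gamma_pos_of_pos (show 0 < (m : ℝ) + β by positivity)
  rw [norm_div, norm_pow, norm_neg, Real.norm_eq_abs, Real.norm_of_nonneg (by positivity)]

theorem hasDerivAt_besselClifford {β : ℝ} (hβ : 0 < β) (z : ℝ) :
    HasDerivAt (besselClifford β) (-besselClifford (β + 1) z) z := by
  have hΓ : ∀ m : ℕ, 0 < Real.Gamma (m + β) := fun m =>
    Real.Gamma_pos_of_pos (by positivity)
  have hstep : ∀ (c : ℝ) (m : ℕ), ((m + 1 : ℕ) : ℝ) * c ^ (m + 1 - 1) /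
      ((m + 1).factorial * Real.Gamma ((m + 1 : ℕ) + β))
      = c ^ m / (m.factorial * Real.Gamma (m + (β + 1))) := by
    intro c m
    have h1 : ((m + 1 : ℕ) : ℝ) + β = m + (β + 1) := by push_cast; ring
    have h2 : ((m + 1).factorial : ℝ) = ((m + 1 : ℕ) : ℝ) * m.factorial := by
      rw [Nat.factorial_succ]; push_cast; ring
    have h3 := (hΓ (m + 1)).ne'
    rw [h1] at h3
    rw [h1, h2, Nat.add_sub_cancel]
    have : ((m + 1 : ℕ) : ℝ) ≠ 0 := by positivity
    field_simp
  have key := hasDerivAt_tsum_of_isPreconnected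
    (g := fun (m : ℕ) z => (-z) ^ m / (m.factorial * Real.Gamma (m + β)))
    (g' := fun (m : ℕ) z => ((m : ℝ) * (-z) ^ (m - 1) * (-1)) / (m.factorial * Real.Gamma (m + β)))
    (u := fun (m : ℕ) => (m : ℝ) * (|z| + 1) ^ (m - 1) / (m.factorial * Real.Gamma (m + β)))
    (t := Metric.ball 0 (|z| + 1)) (y₀ := 0) (y := z) ?_ Metric.isOpen_ball
    (convex_ball 0 _).isPreconnected ?_ ?_ ?_ ?_ ?_
  · have hs : Summable fun m : ℕ => (m * (-z) ^ (m - 1) * (-1)) /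
        (m.factorial * Real.Gamma (m + β)) := by
      rw [← summable_nat_add_iff 1]
      refine (summable_besselClifford (show 0 < β + 1 by positivity) z).neg.congr fun m => ?_
      rw [← hstep]; ring
    have he : -besselClifford (β + 1) z = ∑' m : ℕ, (m * (-z) ^ (m - 1) * (-1)) /
        (m.factorial * Real.Gamma (m + β)) := by
      rw [hs.tsum_eq_zero_add, besselClifford, ← tsum_neg]
      simp only [Nat.cast_zero, zero_mul, zero_div, zero_add]
      refine tsum_congr fun m => ?_
      rw [← hstep]; ring
    rw [he]
    exact key
  · rw [← summable_nat_add_iff 1]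
    refine (summable_besselClifford_abs (show 0 < β + 1 by positivity) (|z| + 1)).congr fun m => ?_
    rw [← hstep, abs_of_nonneg (show 0 ≤ |z| + 1 by positivity)]
  · intro m y _
    have := ((hasDerivAt_id y).neg.pow m).div_const (m.factorial * Real.Gamma (m + β))
    simpa using this
  · intro m y hy
    rw [mem_ball_zero_iff, Real.norm_eq_abs] at hy
    have := hΓ m
    rw [norm_div, norm_mul, norm_mul, norm_pow, norm_neg, Real.norm_eq_abs y,
      Real.norm_of_nonneg (show 0 ≤ (m.factorial : ℝ) * Real.Gamma (m + β) by positivity)]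
    simp only [norm_neg, norm_one, mul_one, RCLike.norm_natCast]
    gcongr
  · simp; positivity
  · simpa using summable_besselClifford hβ 0
  · simp

theorem continuous_besselClifford {β : ℝ} (hβ : 0 < β) : Continuous (besselClifford β) :=
  continuous_iff_continuousAt.2 fun z => (hasDerivAt_besselClifford hβ z).continuousAt

theorem besselClifford_zero (β : ℝ) : besselClifford β 0 = 1 / Real.Gamma β := by
  rw [besselClifford, tsum_eq_single 0]
  · simp
  · intro m hm; simp [hm]

theorem besselClifford_recurrence {β : ℝ} (hβ : 0 < β) (z : ℝ) :
    besselClifford β z = β * besselClifford (β + 1) z - z * besselClifford (β + 2) z := by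
  have h1 := (summable_besselClifford (show 0 < β + 1 by positivity) z).hasSum.mul_left β
  have h2 := ((summable_besselClifford (show 0 < β + 2 by positivity) z).hasSum).mul_left (-z)
  have h3 : HasSum (fun m : ℕ => m * ((-z) ^ m / (m.factorial * Real.Gamma (m + (β + 1)))))
      (-z * besselClifford (β + 2) z) := by
    rw [← hasSum_nat_add_iff' 1]
    simp only [Finset.range_one, Finset.sum_singleton, Nat.cast_zero, zero_mul, sub_zero]
    refine h2.congr_fun ?_
    intro m
    have e1 : ((m + 1 : ℕ) : ℝ) + (β + 1) = m + (β + 2) := by push_cast; ring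
    have e2 : ((m + 1).factorial : ℝ) = ((m + 1 : ℕ) : ℝ) * m.factorial := by
      rw [Nat.factorial_succ]; push_cast; ring
    have e3 := (Real.Gamma_pos_of_pos (show 0 < (m : ℝ) + (β + 2) by positivity)).ne'
    rw [e1, e2, pow_succ]
    have : ((m + 1 : ℕ) : ℝ) ≠ 0 := by positivity
    field_simp
  have h4 := h1.add h3
  have h5 : besselClifford β z = β * besselClifford (β + 1) z + -z * besselClifford (β + 2) z := by
    refine HasSum.unique ((summable_besselClifford hβ z).hasSum) (h4.congr_fun ?_)
    intro m
    have e3 := (Real.Gamma_pos_of_pos (show 0 < (m : ℝ) + β by positivity)).ne'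
    have e4 : (m : ℝ) + β ≠ 0 := by positivity
    rw [← add_assoc (m : ℝ), Real.Gamma_add_one e4]
    field_simp
    ring
  rw [h5]; ring

/-- This is the energy of the equation zu'' + βu' + u = 0, since u' = -J_{β+1}. The sign of its
derivative depends only on whether β exceeds 1/2. -/
theorem hasDerivAt_besselClifford_energy {β : ℝ} (hβ : 0 < β) (z : ℝ) :
    HasDerivAt (fun z => besselClifford β z ^ 2 + z * besselClifford (β + 1) z ^ 2)
      ((1 - 2 * β) * besselClifford (β + 1) z ^ 2) z := by
  have h0 := hasDerivAt_besselClifford hβ z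
  have h1 := hasDerivAt_besselClifford (show 0 < β + 1 by positivity) z
  convert! (h0.pow 2).add ((hasDerivAt_id z).mul (h1.pow 2)) using 1
  have hr := besselClifford_recurrence hβ z
  have e : β + 1 + 1 = β + 2 := by ring
  simp only [e, id, Pi.pow_apply, Nat.cast_ofNat]
  rw [hr]; ring

theorem besselClifford_energy_le {β : ℝ} (hβ : 1 / 2 ≤ β) {z : ℝ} (hz : 0 ≤ z) :
    besselClifford β z ^ 2 + z * besselClifford (β + 1) z ^ 2 ≤ (1 / Real.Gamma β) ^ 2 := by
  have hβ0 : 0 < β := by linarith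
  have hd := hasDerivAt_besselClifford_energy hβ0
  have := antitoneOn_of_deriv_nonpos (convex_Ici (0 : ℝ))
    (fun x _ => (hd x).continuousAt.continuousWithinAt)
    (fun x _ => (hd x).differentiableAt.differentiableWithinAt)
    (fun x _ => by
      rw [(hd x).deriv]
      exact mul_nonpos_of_nonpos_of_nonneg (by linarith) (sq_nonneg _))
  have h := this (Set.mem_Ici.2 le_rfl) (Set.mem_Ici.2 hz) hz
  simpa [besselClifford_zero] using h

theorem abs_besselClifford_le {β : ℝ} (hβ : 1 / 2 ≤ β) {z : ℝ} (hz : 0 ≤ z) :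
    |besselClifford β z| ≤ 1 / Real.Gamma β := by
  have hΓ := Real.Gamma_pos_of_pos (show 0 < β by linarith)
  refine abs_le_of_sq_le_sq ?_ (by positivity)
  have h := besselClifford_energy_le hβ hz
  have : 0 ≤ z * besselClifford (β + 1) z ^ 2 := by positivity
  linarith

/-- For β < 1/2 the energy increases, so the recurrence is used to pass to the indices β+1 and β+2,
where the energy bound applies. Linear growth is enough against exponentially decaying functions. -/
theorem exists_abs_besselClifford_le {β : ℝ} (hβ : 0 < β) :
    ∃ C, 0 ≤ C ∧ ∀ z, 0 ≤ z → |besselClifford β z| ≤ C * (1 + z) := by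
  have h1 := Real.Gamma_pos_of_pos (show 0 < β + 1 by linarith)
  have h2 := Real.Gamma_pos_of_pos (show 0 < β + 2 by linarith)
  refine ⟨β * (1 / Real.Gamma (β + 1)) + 1 / Real.Gamma (β + 2), by positivity, fun z hz => ?_⟩
  rw [besselClifford_recurrence hβ]
  have a1 := abs_besselClifford_le (show 1 / 2 ≤ β + 1 by linarith) hz
  have a2 := abs_besselClifford_le (show 1 / 2 ≤ β + 2 by linarith) hz
  refine (abs_sub _ _).trans ?_
  rw [abs_mul, abs_mul, abs_of_nonneg hz, abs_of_pos hβ]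
  have b1 : 0 ≤ β * (1 / Real.Gamma (β + 1)) * z := by positivity
  have b2 : 0 ≤ 1 / Real.Gamma (β + 2) := by positivity
  nlinarith [mul_le_mul_of_nonneg_left a1 hβ.le, mul_le_mul_of_nonneg_left a2 hz]

/-- The duplication formula for Γ at integers, which turns the series of index 1/2 and 3/2 into
those of cosine and sine. -/
theorem four_pow_mul_factorial_mul_Gamma (m : ℕ) :
    (4 : ℝ) ^ m * (m.factorial * Real.Gamma (m + 1 / 2)) = (2 * m).factorial * √Real.pi := by
  induction m with
  | zero => simpa using Real.Gamma_one_half_eq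
  | succ m ih =>
    have h : ((m + 1 : ℕ) : ℝ) + 1 / 2 = (m + 1 / 2) + 1 := by push_cast; ring
    have h2 : (((2 * (m + 1)).factorial : ℕ) : ℝ)
        = (2 * m + 2) * ((2 * m + 1) * (2 * m).factorial) := by
      rw [show 2 * (m + 1) = 2 * m + 1 + 1 by ring, Nat.factorial_succ, Nat.factorial_succ]
      push_cast; ring
    rw [h, Real.Gamma_add_one (by positivity), h2, Nat.factorial_succ]
    push_cast
    linear_combination (2 * (m : ℝ) + 2) * (2 * m + 1) * ih

theorem besselClifford_one_half {t : ℝ} :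
    besselClifford (1 / 2) (t ^ 2 / 4) = Real.cos t / √Real.pi := by
  have h := (Real.hasSum_cos t).div_const √Real.pi
  refine HasSum.tsum_eq (h.congr_fun ?_)
  intro m
  have e := four_pow_mul_factorial_mul_Gamma m
  have hπ := Real.sqrt_pos.2 Real.pi_pos
  have hΓ := Real.Gamma_pos_of_pos (show 0 < (m : ℝ) + 1 / 2 by positivity)
  rw [div_div, ← e, neg_pow, div_pow, ← pow_mul]
  field_simp

theorem besselClifford_three_half {t : ℝ} (ht : t ≠ 0) :
    besselClifford (3 / 2) (t ^ 2 / 4) = 2 * (Real.sin t / t) / √Real.pi := by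
  have h := (((Real.hasSum_sin t).div_const t).mul_left 2).div_const √Real.pi
  refine HasSum.tsum_eq (h.congr_fun ?_)
  intro m
  have e := four_pow_mul_factorial_mul_Gamma m
  have hπ := Real.sqrt_pos.2 Real.pi_pos
  have hΓ := Real.Gamma_pos_of_pos (show 0 < (m : ℝ) + 1 / 2 by positivity)
  have e1 : (m : ℝ) + 3 / 2 = (m + 1 / 2) + 1 := by ring
  have e2 : ((2 * m + 1).factorial : ℝ) * √Real.pi
      = (2 * m + 1) * ((4 : ℝ) ^ m * (m.factorial * Real.Gamma (m + 1 / 2))) := by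
    rw [e, Nat.factorial_succ]; push_cast; ring
  have e3 : 2 * ((-1) ^ m * t ^ (2 * m + 1) / ((2 * m + 1).factorial : ℝ) / t) / √Real.pi
      = 2 * ((-1) ^ m * t ^ (2 * m)) / (((2 * m + 1).factorial : ℝ) * √Real.pi) := by
    rw [pow_succ]; field_simp
  rw [e3, e2, e1, Real.Gamma_add_one (by positivity), neg_pow, div_pow, ← pow_mul]
  field_simp

/-- By the mean value inequality the value moves by at most 1/Γ(β+2) on [0,1], which is less than
the initial value 1/Γ(β+1). It serves to make the energy at 1 positive. -/
theorem besselClifford_add_one_pos {β : ℝ} (hβ : 0 < β) : 0 < besselClifford (β + 1) 1 := by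
  have h1 := Real.Gamma_pos_of_pos (show 0 < β + 1 by linarith)
  have hd := hasDerivAt_besselClifford (show 0 < β + 1 by linarith)
  have := Convex.norm_image_sub_le_of_norm_hasDerivWithin_le (s := Set.Icc (0 : ℝ) 1)
    (C := 1 / Real.Gamma (β + 1 + 1)) (x := 0) (y := 1)
    (fun x _ => (hd x).hasDerivWithinAt) (fun x hx => by
      rw [norm_neg, Real.norm_eq_abs]
      exact abs_besselClifford_le (by linarith) hx.1) (convex_Icc _ _) (by simp) (by simp)
  rw [besselClifford_zero, Real.Gamma_add_one (show β + 1 ≠ 0 by positivity), Real.norm_eq_abs] at this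
  have h2 := (abs_le.1 this).1
  have h3 : 1 / ((β + 1) * Real.Gamma (β + 1)) < 1 / Real.Gamma (β + 1) := by
    apply one_div_lt_one_div_of_lt h1
    nlinarith
  simp only [sub_zero, norm_one, mul_one] at h2
  linarith

/-! ### Energy decay and unboundedness for small index. -/

/-- Two-sided decay of the energy `U² + zU'²` of `U = besselClifford (β + 1)`, at the rate
`z ^ (-(β + 1/2))`. -/
theorem exists_besselClifford_energy_bounds {β : ℝ} (hβ : 0 < β) (hβ' : β < 1 / 2) :
    ∃ c C : ℝ, 0 < c ∧ ∀ z : ℝ, 1 ≤ z →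
      c ≤ z ^ (β + 1 / 2) *
        (besselClifford (β + 1) z ^ 2 + z * besselClifford (β + 2) z ^ 2) ∧
      z ^ (β + 1 / 2) *
        (besselClifford (β + 1) z ^ 2 + z * besselClifford (β + 2) z ^ 2) ≤ C := by
  set U := besselClifford (β + 1) with hU
  set V := besselClifford (β + 2) with hV
  set γ := β + 1 / 2 with hγ
  have hUd : ∀ z, HasDerivAt U (-V z) z := fun z => by
    have := hasDerivAt_besselClifford (show 0 < β + 1 by linarith) z
    rwa [show β + 1 + 1 = β + 2 by ring] at this
  have hVd : ∀ z, 0 < z → HasDerivAt V ((U z - (β + 1) * V z) / z) z := fun z hz => by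
    have h := hasDerivAt_besselClifford (show 0 < β + 2 by linarith) z
    have hr := besselClifford_recurrence (show 0 < β + 1 by linarith) z
    rw [show β + 1 + 1 = β + 2 by ring, show β + 1 + 2 = β + 2 + 1 by ring] at hr
    convert h using 1
    rw [hU, hV, hr]; field_simp; ring
  have hSd : ∀ z, HasDerivAt (fun z => U z ^ 2 + z * V z ^ 2) (-(2 * γ) * V z ^ 2) z :=
    fun z => by
      have h := hasDerivAt_besselClifford_energy (show 0 < β + 1 by linarith) z
      rw [show β + 1 + 1 = β + 2 by ring] at h
      convert h using 1
      rw [hγ]; ring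
  -- The derivative of z^γ(U² + zV²) is γz^{γ-1}(U² - zV²), which oscillates without decaying fast
  -- enough to be integrated in absolute value. The correction -γUV cancels exactly this term and
  -- leaves a multiple of z^{γ-1}UV.
  set R : ℝ → ℝ := fun z => z ^ γ * (U z ^ 2 + z * V z ^ 2 - γ * (U z * V z)) with hR
  have hRd : ∀ z, 0 < z → HasDerivAt R (γ / 2 * (z ^ γ / z) * (U z * V z)) z := fun z hz => by
    have h1 := (Real.hasDerivAt_rpow_const (p := γ) (Or.inl hz.ne'))
    have h := h1.mul ((hSd z).sub (((hUd z).mul (hVd z hz)).const_mul γ))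
    convert! h using 1
    rw [Real.rpow_sub_one hz.ne', hγ]
    simp only [Pi.mul_apply, Pi.sub_apply]
    field_simp
    ring
  have hUV : ∀ z, 1 ≤ z → |U z * V z| ≤ (U z ^ 2 + z * V z ^ 2) / (2 * √z) := fun z hz => by
    have hz0 : 0 < z := by linarith
    have hs := Real.sqrt_pos.2 hz0
    rw [le_div_iff₀ (by positivity), abs_mul]
    have h1 := sq_nonneg (|U z| - √z * |V z|)
    have h2 := Real.sq_sqrt hz0.le
    have h3 : (|U z| - √z * |V z|) ^ 2
        = U z ^ 2 + z * V z ^ 2 - |U z| * |V z| * (2 * √z) := by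
      rw [← sq_abs (U z), ← sq_abs (V z)]
      linear_combination |V z| ^ 2 * h2
    linarith
  have hγ0 : 0 < γ := by rw [hγ]; linarith
  have hγ1 : γ < 1 := by rw [hγ]; linarith
  have hS0 : ∀ z, 1 ≤ z → 0 ≤ U z ^ 2 + z * V z ^ 2 := fun z hz => by positivity
  have hUV' : ∀ z, 1 ≤ z → |γ * (U z * V z)| ≤ (U z ^ 2 + z * V z ^ 2) / 2 := fun z hz => by
    rw [abs_mul, abs_of_pos hγ0]
    have h1 := hUV z hz
    have h2 : (U z ^ 2 + z * V z ^ 2) / (2 * √z) ≤ (U z ^ 2 + z * V z ^ 2) / 2 := by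
      have := Real.one_le_sqrt.2 hz
      apply div_le_div_of_nonneg_left (hS0 z hz) (by norm_num); linarith
    nlinarith [abs_nonneg (U z * V z)]
  have hRlow : ∀ z, 1 ≤ z → z ^ γ * (U z ^ 2 + z * V z ^ 2) / 2 ≤ R z := fun z hz => by
    have h := (abs_le.1 (hUV' z hz)).2
    have hp : 0 < z ^ γ := Real.rpow_pos_of_pos (by linarith) _
    simp only [hR]
    nlinarith
  have hRup : ∀ z, 1 ≤ z → R z ≤ 3 / 2 * (z ^ γ * (U z ^ 2 + z * V z ^ 2)) := fun z hz => by
    have h := (abs_le.1 (hUV' z hz)).1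
    have hp : 0 < z ^ γ := Real.rpow_pos_of_pos (by linarith) _
    simp only [hR]
    nlinarith
  -- A Grönwall inequality with the coefficient 1/(2z^{3/2}), which is integrable at infinity with
  -- primitive -1/√z. So multiplying R by exp(∓1/√z) gives an increasing and a decreasing function.
  have hRbd : ∀ z, 1 ≤ z → |γ / 2 * (z ^ γ / z) * (U z * V z)| ≤ 1 / (2 * √z * z) * R z :=
    fun z hz => by
    have hz0 : 0 < z := by linarith
    have hp : 0 < z ^ γ := Real.rpow_pos_of_pos hz0 _
    have hs := Real.sqrt_pos.2 hz0
    rw [abs_mul, abs_of_pos (by positivity)]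
    calc γ / 2 * (z ^ γ / z) * |U z * V z|
        ≤ 1 / 2 * (z ^ γ / z) * ((U z ^ 2 + z * V z ^ 2) / (2 * √z)) := by
          have := hUV z hz
          have := hS0 z hz
          gcongr
      _ = 1 / (2 * √z * z) * (z ^ γ * (U z ^ 2 + z * V z ^ 2) / 2) := by
          field_simp
      _ ≤ _ := by
          have := hRlow z hz
          gcongr
  have hE : ∀ (σ z : ℝ), 0 < z → HasDerivAt (fun z => R z * Real.exp (σ * (√z)⁻¹))
      (Real.exp (σ * (√z)⁻¹) * (γ / 2 * (z ^ γ / z) * (U z * V z)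
        - σ * (1 / (2 * √z * z) * R z))) z := fun σ z hz => by
    have hs := Real.sqrt_pos.2 hz
    have h1 := ((((Real.hasDerivAt_sqrt hz.ne').inv hs.ne').const_mul σ).exp)
    convert! (hRd z hz).mul h1 using 1
    have h2 := Real.sq_sqrt hz.le
    simp only [Pi.inv_apply]
    rw [h2]
    field_simp
    ring
  have hint : ∀ z ∈ interior (Set.Ici (1 : ℝ)), 1 ≤ z := fun z hz => by
    rw [interior_Ici] at hz; exact le_of_lt hz
  have hmono := monotoneOn_of_deriv_nonneg (convex_Ici (1 : ℝ))
    (f := fun z => R z * Real.exp (-1 * (√z)⁻¹))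
    (fun x hx => (hE _ x (lt_of_lt_of_le one_pos hx)).continuousAt.continuousWithinAt)
    (fun x hx => (hE _ x (lt_of_lt_of_le one_pos (hint x hx))).differentiableAt.differentiableWithinAt)
    (fun x hx => by
      rw [(hE _ x (lt_of_lt_of_le one_pos (hint x hx))).deriv]
      have := (abs_le.1 (hRbd x (hint x hx))).1
      exact mul_nonneg (Real.exp_pos _).le (by linarith))
  have hanti := antitoneOn_of_deriv_nonpos (convex_Ici (1 : ℝ))
    (f := fun z => R z * Real.exp (1 * (√z)⁻¹))
    (fun x hx => (hE _ x (lt_of_lt_of_le one_pos hx)).continuousAt.continuousWithinAt)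
    (fun x hx => (hE _ x (lt_of_lt_of_le one_pos (hint x hx))).differentiableAt.differentiableWithinAt)
    (fun x hx => by
      rw [(hE _ x (lt_of_lt_of_le one_pos (hint x hx))).deriv]
      have := (abs_le.1 (hRbd x (hint x hx))).2
      exact mul_nonpos_of_nonneg_of_nonpos (Real.exp_pos _).le (by linarith))
  have hR1 : 0 < R 1 := by
    have h1 := hRlow 1 le_rfl
    have h2 : 0 < U 1 := besselClifford_add_one_pos hβ
    have h3 : 0 < (1 : ℝ) ^ γ * (U 1 ^ 2 + 1 * V 1 ^ 2) / 2 := by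
      rw [Real.one_rpow]; positivity
    linarith
  -- The factors 2/3 and 2 undo the comparison of R with z^γ times the energy; exp(∓1) is the value
  -- of the integrating factor at z = 1.
  refine ⟨2 / 3 * (R 1 * Real.exp (-1)), 2 * (R 1 * Real.exp 1), by positivity, fun z hz => ?_⟩
  have hz0 : 0 < z := by linarith
  have hs : 0 < (√z)⁻¹ := inv_pos.2 (Real.sqrt_pos.2 hz0)
  have m1 := hmono (Set.mem_Ici.2 le_rfl) (Set.mem_Ici.2 hz) hz
  have m2 := hanti (Set.mem_Ici.2 le_rfl) (Set.mem_Ici.2 hz) hz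
  simp only [Real.sqrt_one, inv_one, mul_one, one_mul] at m1 m2
  have hRz : 0 ≤ R z := le_trans (by have := hS0 z hz; positivity) (hRlow z hz)
  have m3 : R z * Real.exp (-1 * (√z)⁻¹) ≤ R z :=
    mul_le_of_le_one_right hRz (Real.exp_le_one_iff.2 (by linarith))
  have m4 : R z ≤ R z * Real.exp (√z)⁻¹ :=
    le_mul_of_one_le_right hRz (Real.one_le_exp hs.le)
  have m5 := hRlow z hz
  have m6 := hRup z hz
  constructor <;> linarith

theorem besselClifford_sub_unbounded {β : ℝ} (hβ : 0 < β) (hβ' : β < 1 / 2) (M : ℝ) :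
    ∃ z, 0 < z ∧ M < |besselClifford β z - z * besselClifford (β + 2) z| := by
  by_contra! hM
  obtain ⟨c, C, hc, hbd⟩ := exists_besselClifford_energy_bounds hβ hβ'
  set U := besselClifford (β + 1) with hU
  set V := besselClifford (β + 2) with hV
  set γ := β + 1 / 2 with hγ
  have hγ0 : 0 < γ := by rw [hγ]; linarith
  have hγ1 : γ < 1 := by rw [hγ]; linarith
  -- After the recurrence the expression is βU - 2zV with |βU| ≤ 1/Γ(β+1), because β < 1; this
  -- bounds |2zV|.
  set K := (M + 1 / Real.Gamma (β + 1)) / 2 with hK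
  have hVb : ∀ z, 0 < z → |z * V z| ≤ K := fun z hz => by
    have h1 := hM z hz
    have h2 := abs_besselClifford_le (show 1 / 2 ≤ β + 1 by linarith) hz.le
    rw [besselClifford_recurrence hβ, ← hU, ← hV] at h1
    rw [← hU] at h2
    have h3 : |β * U z| ≤ 1 / Real.Gamma (β + 1) := by
      rw [abs_mul, abs_of_pos hβ]
      nlinarith [abs_nonneg (U z)]
    rw [abs_le] at h1 h3 ⊢
    rw [hK]
    constructor <;> linarith [h1.1, h1.2, h3.1, h3.2]
  have hSd : ∀ z, HasDerivAt (fun z => U z ^ 2 + z * V z ^ 2) (-(2 * γ) * V z ^ 2) z :=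
    fun z => by
      have h := hasDerivAt_besselClifford_energy (show 0 < β + 1 by linarith) z
      rw [show β + 1 + 1 = β + 2 by ring] at h
      convert h using 1
      rw [hγ]; ring
  -- The energy has derivative -2γV² ≥ -2K²/z², as γ < 1. Hence energy minus A/z is increasing; it
  -- tends to 0, so it is nonpositive.
  set A := 2 * K ^ 2 with hA
  have hFd : ∀ z, 0 < z → HasDerivAt (fun z => U z ^ 2 + z * V z ^ 2 - A * z⁻¹)
      (-(2 * γ) * V z ^ 2 - A * (-(z ^ 2)⁻¹)) z := fun z hz =>
    (hSd z).sub ((hasDerivAt_inv hz.ne').const_mul A)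
  have hint : ∀ z ∈ interior (Set.Ici (1 : ℝ)), 0 < z := fun z hz => by
    rw [interior_Ici] at hz; exact lt_trans one_pos hz
  have hmono := monotoneOn_of_deriv_nonneg (convex_Ici (1 : ℝ))
    (fun x hx => (hFd x (lt_of_lt_of_le one_pos hx)).continuousAt.continuousWithinAt)
    (fun x hx => (hFd x (hint x hx)).differentiableAt.differentiableWithinAt)
    (fun x hx => by
      have hx0 := hint x hx
      rw [(hFd x hx0).deriv]
      have h1 := hVb x hx0
      have h2 : (x * V x) ^ 2 ≤ K ^ 2 := sq_le_sq' (abs_le.1 h1).1 (abs_le.1 h1).2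
      have h3 : V x ^ 2 ≤ K ^ 2 * (x ^ 2)⁻¹ := by
        rw [← div_eq_mul_inv, le_div_iff₀ (by positivity)]; linarith [mul_pow x (V x) 2]
      have h4 : γ * V x ^ 2 ≤ V x ^ 2 := by nlinarith [sq_nonneg (V x)]
      rw [hA]; linarith)
  have hS : ∀ z, 1 ≤ z → U z ^ 2 + z * V z ^ 2 ≤ C * z ^ (-γ) := fun z hz => by
    have hz0 : 0 < z := by linarith
    rw [Real.rpow_neg hz0.le, ← div_eq_mul_inv, le_div_iff₀ (by positivity)]
    linarith [(hbd z hz).2]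
  have hlim : Filter.Tendsto (fun z => U z ^ 2 + z * V z ^ 2 - A * z⁻¹) Filter.atTop
      (nhds (0 - A * 0)) := by
    refine Filter.Tendsto.sub ?_ (tendsto_inv_atTop_zero.const_mul A)
    have h0 : Filter.Tendsto (fun z : ℝ => C * z ^ (-γ)) Filter.atTop (nhds 0) := by
      simpa using (tendsto_rpow_neg_atTop hγ0).const_mul C
    refine squeeze_zero' ?_ ?_ h0
    · filter_upwards [Filter.eventually_ge_atTop 1] with z hz
      positivity
    · filter_upwards [Filter.eventually_ge_atTop 1] with z hz using hS z hz
  have hle : ∀ z, 1 ≤ z → U z ^ 2 + z * V z ^ 2 ≤ A * z⁻¹ := fun z hz => by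
    have := ge_of_tendsto hlim (b := U z ^ 2 + z * V z ^ 2 - A * z⁻¹) (by
      filter_upwards [Filter.eventually_ge_atTop z] with w hw
      exact hmono (Set.mem_Ici.2 hz) (Set.mem_Ici.2 (hz.trans hw)) hw)
    linarith
  have htop := tendsto_rpow_atTop (show 0 < 1 - γ by linarith)
  obtain ⟨z, hz1, hz⟩ :=
    ((htop.eventually_gt_atTop (A / c)).and (Filter.eventually_ge_atTop 1)).exists
  have hz0 : 0 < z := by linarith
  have h1 := (hbd z hz).1
  have h2 := mul_le_mul_of_nonneg_left (hle z hz) (Real.rpow_pos_of_pos hz0 γ).le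
  rw [Real.rpow_sub hz0, Real.rpow_one, div_lt_div_iff₀ hc (by positivity)] at hz1
  have h3 : c * z ≤ A * z ^ γ := by
    have := h1.trans h2
    have h4 := mul_le_mul_of_nonneg_right this hz0.le
    have h5 : z ^ γ * (A * z⁻¹) * z = A * z ^ γ := by field_simp
    linarith
  linarith

/-! ### Laguerre polynomials and the Hankel-type transform. -/

/-- The coefficient of `t ^ j` in `laguerre s ν t`. -/
def laguerreCoeff (s : ℕ) (ν : ℝ) (j : ℕ) : ℝ :=
  (-1) ^ j * Real.Gamma (ν + s + 1) / ((s - j).factorial * Real.Gamma (ν + j + 1) * j.factorial)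

theorem laguerre_eq_sum (s : ℕ) (ν t : ℝ) :
    laguerre s ν t = ∑ j ∈ Finset.range (s + 1), laguerreCoeff s ν j * t ^ j := by
  refine Finset.sum_congr rfl fun j _ => ?_
  rw [laguerreCoeff, div_mul_div_comm, div_mul_eq_mul_div]

theorem Gamma_add_nat_pos {ν : ℝ} (hν : -1 < ν) (j : ℕ) : 0 < Real.Gamma (ν + j + 1) := by
  have : (0 : ℝ) ≤ j := j.cast_nonneg
  exact Real.Gamma_pos_of_pos (by linarith)

theorem laguerreCoeff_self_ne_zero {ν : ℝ} (hν : -1 < ν) (s : ℕ) :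
    laguerreCoeff s ν s ≠ 0 := by
  have := Gamma_add_nat_pos hν s
  rw [laguerreCoeff]
  positivity

theorem Gamma_add_nat_succ {ν : ℝ} (hν : -1 < ν) (j : ℕ) :
    Real.Gamma (ν + (j + 1 : ℕ) + 1) = (ν + j + 1) * Real.Gamma (ν + j + 1) := by
  have : (0 : ℝ) ≤ j := j.cast_nonneg
  rw [← Real.Gamma_add_one (by linarith)]
  congr 1; push_cast; ring

/-- A Chu–Vandermonde identity. -/
theorem Gamma_add_nat_eq_sum {ν : ℝ} (hν : -1 < ν) (j m : ℕ) :
    Real.Gamma (ν + (j + m : ℕ) + 1) / Real.Gamma (ν + m + 1) =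
      ∑ i ∈ Finset.range (j + 1), (j.choose i : ℝ) *
        (Real.Gamma (ν + j + 1) / Real.Gamma (ν + i + 1)) * (m.descFactorial i : ℝ) := by
  induction j with
  | zero =>
    have h := (Gamma_add_nat_pos hν m).ne'
    have h0 := (Gamma_add_nat_pos hν 0).ne'
    rw [Nat.cast_zero, add_zero] at h0
    simp [h, h0]
  | succ j ih =>
    have hr : ∀ i : ℕ, Real.Gamma (ν + j + 1) / Real.Gamma (ν + i + 1)
        = (ν + i + 1) * (Real.Gamma (ν + j + 1) / Real.Gamma (ν + (i + 1 : ℕ) + 1)) := by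
      intro i
      have h1 := (Gamma_add_nat_pos hν i).ne'
      have h2 : ν + i + 1 ≠ 0 := by
        have : (0 : ℝ) ≤ i := i.cast_nonneg
        linarith
      rw [Gamma_add_nat_succ hν i]
      field_simp
    have hd : ∀ i : ℕ, (m.descFactorial (i + 1) : ℝ) = (m - i) * m.descFactorial i := by
      intro i
      rw [Nat.descFactorial_succ]
      rcases le_or_gt i m with h | h
      · push_cast [Nat.cast_sub h]; ring
      · simp [Nat.descFactorial_of_lt h]
    have hc : ∀ i ∈ Finset.range (j + 1), ((j.choose (i + 1) : ℕ) : ℝ) * (i + 1)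
        = j.choose i * (j - i) := by
      intro i hi
      have h := Nat.choose_succ_right_eq j i
      have h' : i ≤ j := by simpa [Nat.lt_succ_iff] using hi
      have := congrArg (Nat.cast (R := ℝ)) h
      push_cast [Nat.cast_sub h'] at this
      exact this
    rw [show j + 1 + m = (j + m) + 1 by ring, Gamma_add_nat_succ hν (j + m), mul_div_assoc, ih]
    set r : ℕ → ℝ := fun i => Real.Gamma (ν + j + 1) / Real.Gamma (ν + i + 1) with hrdef
    have hR : ∀ i : ℕ, Real.Gamma (ν + (j + 1 : ℕ) + 1) / Real.Gamma (ν + i + 1)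
        = (ν + j + 1) * r i := by
      intro i; rw [Gamma_add_nat_succ hν j, hrdef]; ring
    simp_rw [hR]
    rw [Finset.sum_range_succ' _ (j + 1)]
    have e1 : ∑ i ∈ Finset.range (j + 1), (j.choose i : ℝ) * r i * m.descFactorial i
        = ∑ i ∈ Finset.range (j + 1), (j.choose (i + 1) : ℝ) * r (i + 1) * m.descFactorial (i + 1)
          + r 0 := by
      have h1 := Finset.sum_range_succ (fun i => (j.choose i : ℝ) * r i * m.descFactorial i) (j + 1)
      have h2 := Finset.sum_range_succ' (fun i => (j.choose i : ℝ) * r i * m.descFactorial i) (j + 1)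
      simp only [Nat.choose_succ_self, Nat.cast_zero, zero_mul, add_zero, Nat.choose_zero_right,
        Nat.cast_one, one_mul, Nat.descFactorial_zero, mul_one] at h1 h2
      rw [← h1, h2]
    have e2 : ∑ i ∈ Finset.range (j + 1), i * ((j.choose i : ℝ) * r i * m.descFactorial i)
        = ∑ i ∈ Finset.range (j + 1),
          (i + 1) * ((j.choose (i + 1) : ℝ) * r (i + 1) * m.descFactorial (i + 1)) := by
      have h1 := Finset.sum_range_succ
        (fun i : ℕ => i * ((j.choose i : ℝ) * r i * m.descFactorial i)) (j + 1)
      have h2 := Finset.sum_range_succ'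
        (fun i : ℕ => i * ((j.choose i : ℝ) * r i * m.descFactorial i)) (j + 1)
      simp only [Nat.choose_succ_self, Nat.cast_zero, zero_mul, add_zero, mul_zero,
        Nat.cast_add, Nat.cast_one] at h1 h2
      rw [← h1, h2]
    -- The new factor is split as ν+j+m+1 = (ν+j+1) + i + (m-i). The last piece raises the falling
    -- factorial, the first two combine by Pascal's rule after a shift of the index.
    have e3 : (ν + ((j + m : ℕ) : ℝ) + 1) *
        ∑ i ∈ Finset.range (j + 1), (j.choose i : ℝ) * r i * m.descFactorial i
        = (ν + j + 1) * ∑ i ∈ Finset.range (j + 1), (j.choose i : ℝ) * r i * m.descFactorial i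
        + ∑ i ∈ Finset.range (j + 1), i * ((j.choose i : ℝ) * r i * m.descFactorial i)
        + ∑ i ∈ Finset.range (j + 1), (m - i) * ((j.choose i : ℝ) * r i * m.descFactorial i) := by
      rw [Finset.mul_sum, Finset.mul_sum, ← Finset.sum_add_distrib, ← Finset.sum_add_distrib]
      refine Finset.sum_congr rfl fun i _ => ?_
      push_cast; ring
    rw [e3, e1, e2, mul_add, Finset.mul_sum]
    simp only [Nat.choose_zero_right, Nat.cast_one, one_mul, Nat.descFactorial_zero, mul_one]
    rw [show ∀ a b c d : ℝ, a + b + c + d = a + c + d + b from fun a b c d => by ring,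
      ← Finset.sum_add_distrib,
      ← Finset.sum_add_distrib]
    congr 1
    refine Finset.sum_congr rfl fun i hi => ?_
    have h1 : r i = (ν + i + 1) * r (i + 1) := hr i
    have h2 := hc i hi
    rw [h1, Nat.choose_succ_succ', hd i]
    push_cast
    linear_combination (r (i + 1) * ((m - i) * m.descFactorial i)) * h2

theorem hasSum_descFactorial_mul_pow_div_factorial (i : ℕ) (y : ℝ) :
    HasSum (fun m : ℕ => (m.descFactorial i : ℝ) * (y ^ m / m.factorial))
      (y ^ i * Real.exp y) := by
  rw [← hasSum_nat_add_iff' i, Finset.sum_eq_zero, sub_zero]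
  · have h := ((NormedSpace.expSeries_div_hasSum_exp (𝔸 := ℝ) y).mul_left (y ^ i))
    rw [← Real.exp_eq_exp_ℝ] at h
    refine h.congr_fun ?_
    intro m
    have h1 := Nat.factorial_mul_descFactorial (show i ≤ m + i by omega)
    rw [Nat.add_sub_cancel] at h1
    have h2 := congrArg (Nat.cast (R := ℝ)) h1
    push_cast at h2
    have h3 : ((m.factorial : ℕ) : ℝ) ≠ 0 := by positivity
    have h4 : (((m + i).factorial : ℕ) : ℝ) ≠ 0 := by positivity
    rw [pow_add]
    field_simp
    linear_combination (y ^ m * y ^ i) * h2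
  · intro m hm
    simp [Nat.descFactorial_of_lt (Finset.mem_range.1 hm)]

/-- Chu–Vandermonde expands the Gamma quotient in falling factorials of m, and each of these sums to
a power of -y times exp(-y). -/
theorem hasSum_pow_mul_Gamma_div {ν : ℝ} (hν : -1 < ν) (j : ℕ) (y : ℝ) :
    HasSum (fun m : ℕ => (-y) ^ m / m.factorial *
        (Real.Gamma (ν + (j + m : ℕ) + 1) / Real.Gamma (ν + m + 1)))
      (j.factorial * laguerre j ν y * Real.exp (-y)) := by
  have h := hasSum_sum (s := Finset.range (j + 1)) fun i _ =>
    (hasSum_descFactorial_mul_pow_div_factorial i (-y)).mul_left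
      ((j.choose i : ℝ) * (Real.Gamma (ν + j + 1) / Real.Gamma (ν + i + 1)))
  convert! h using 1
  · funext m
    rw [Gamma_add_nat_eq_sum hν, Finset.mul_sum]
    refine Finset.sum_congr rfl fun i _ => by ring
  · rw [laguerre_eq_sum, Finset.mul_sum, Finset.sum_mul]
    refine Finset.sum_congr rfl fun i hi => ?_
    have hi' : i ≤ j := by simpa [Nat.lt_succ_iff] using hi
    rw [Nat.cast_choose ℝ hi', laguerreCoeff, neg_pow y]
    have := Gamma_add_nat_pos hν i
    field_simp

/-- After the sums are exchanged, the coefficient of y^i is a binomial expansion of (1-2)^(s-i).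
This sign becomes the Hankel eigenvalue (-1)^s. -/
theorem sum_laguerreCoeff_mul_laguerre {ν : ℝ} (hν : -1 < ν) (s : ℕ) (y : ℝ) :
    ∑ j ∈ Finset.range (s + 1), laguerreCoeff s ν j * 2 ^ j * (j.factorial * laguerre j ν y) =
      (-1) ^ s * laguerre s ν (2 * y) := by
  simp_rw [laguerre_eq_sum, Finset.mul_sum]
  rw [Finset.sum_comm' (t' := Finset.range (s + 1)) (s' := fun i => Finset.Ico i (s + 1))
    (by intro j i; simp only [Finset.mem_range, Finset.mem_Ico]; omega)]
  refine Finset.sum_congr rfl fun i hi => ?_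
  have hi' : i ≤ s := by simpa [Nat.lt_succ_iff] using hi
  rw [Finset.sum_Ico_eq_sum_range, show s + 1 - i = (s - i) + 1 by omega]
  have hb := add_pow (-2 : ℝ) 1 (s - i)
  have h1 : ∀ l ∈ Finset.range (s - i + 1), laguerreCoeff s ν (i + l) * 2 ^ (i + l) *
      ((i + l).factorial * (laguerreCoeff (i + l) ν i * y ^ i)) =
      laguerreCoeff s ν i * (-2) ^ i * y ^ i *
        ((-2) ^ l * 1 ^ (s - i - l) * ((s - i).choose l : ℕ)) := by
    intro l hl
    have hl' : l ≤ s - i := by simpa [Nat.lt_succ_iff] using hl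
    have h2 := (Gamma_add_nat_pos hν (i + l)).ne'
    have h3 := (Gamma_add_nat_pos hν i).ne'
    rw [Nat.cast_choose ℝ hl']
    simp only [laguerreCoeff]
    rw [show s - (i + l) = s - i - l by omega, show i + l - i = l by omega, one_pow,
      neg_pow 2 i, neg_pow 2 l, pow_add, pow_add]
    field_simp
  rw [Finset.sum_congr rfl h1, ← Finset.mul_sum, ← hb, mul_pow, neg_pow 2 i]
  have h4 : (-2 + 1 : ℝ) ^ (s - i) * (-1) ^ i = (-1) ^ s := by
    norm_num
    rw [← pow_add, Nat.sub_add_cancel hi']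
  linear_combination (laguerreCoeff s ν i * 2 ^ i * y ^ i) * h4

theorem integrableOn_rpow_mul_pow_mul_exp {ν : ℝ} (hν : -1 < ν) (j : ℕ) :
    IntegrableOn (fun x : ℝ => x ^ ν * (x ^ j * Real.exp (-x))) (Set.Ioi 0) := by
  have h0 : (0 : ℝ) ≤ j := j.cast_nonneg
  have h := Real.GammaIntegral_convergent (show 0 < ν + j + 1 by linarith)
  refine h.congr_fun (fun x hx => ?_) measurableSet_Ioi
  rw [Set.mem_Ioi] at hx
  simp only
  rw [add_sub_cancel_right, Real.rpow_add hx, Real.rpow_natCast]; ring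

theorem integral_rpow_mul_pow_mul_exp {ν : ℝ} (hν : -1 < ν) (j : ℕ) :
    ∫ x in Set.Ioi (0 : ℝ), x ^ ν * (x ^ j * Real.exp (-x)) = Real.Gamma (ν + j + 1) := by
  have h0 : (0 : ℝ) ≤ j := j.cast_nonneg
  rw [Real.Gamma_eq_integral (show 0 < ν + j + 1 by linarith)]
  refine setIntegral_congr_fun measurableSet_Ioi fun x hx => ?_
  rw [Set.mem_Ioi] at hx
  rw [add_sub_cancel_right, Real.rpow_add hx, Real.rpow_natCast]; ring

theorem integral_pow_mul_besselClifford {ν : ℝ} (hν : -1 < ν) (j : ℕ) (y : ℝ) :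
    ∫ x in Set.Ioi (0 : ℝ), x ^ ν * (x ^ j * Real.exp (-x) * besselClifford (ν + 1) (x * y)) =
      j.factorial * laguerre j ν y * Real.exp (-y) := by
  have hG : ∀ m : ℕ, 0 < Real.Gamma (m + (ν + 1)) := fun m => by
    have := Gamma_add_nat_pos hν m
    rwa [show (m : ℝ) + (ν + 1) = ν + m + 1 by ring]
  set F : ℕ → ℝ → ℝ := fun m x => (-y) ^ m / (m.factorial * Real.Gamma (m + (ν + 1))) *
    (x ^ ν * (x ^ (j + m) * Real.exp (-x))) with hF
  have hFi : ∀ m, Integrable (F m) (volume.restrict (Set.Ioi 0)) := fun m =>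
    (integrableOn_rpow_mul_pow_mul_exp hν (j + m)).const_mul _
  have hint : ∀ (y : ℝ) (m : ℕ), (-y) ^ m / (m.factorial * Real.Gamma (m + (ν + 1))) *
      ∫ x in Set.Ioi (0 : ℝ), x ^ ν * (x ^ (j + m) * Real.exp (-x))
      = (-y) ^ m / m.factorial *
        (Real.Gamma (ν + (j + m : ℕ) + 1) / Real.Gamma (ν + m + 1)) := by
    intro y m
    rw [integral_rpow_mul_pow_mul_exp hν, show (m : ℝ) + (ν + 1) = ν + m + 1 by ring]
    ring
  have hs : Summable fun m => ∫ x in Set.Ioi (0 : ℝ), ‖F m x‖ := by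
    -- At -|y| all terms of the series are nonnegative and equal the integrals of the norms, so the
    -- closed form itself gives absolute convergence.
    refine (hasSum_pow_mul_Gamma_div hν j (-|y|)).summable.congr fun m => ?_
    rw [← hint, neg_neg, ← integral_const_mul]
    refine setIntegral_congr_fun measurableSet_Ioi fun x hx => ?_
    rw [Set.mem_Ioi] at hx
    have := hG m
    simp only [hF]
    rw [norm_mul, norm_div, norm_pow, norm_neg, Real.norm_eq_abs,
      Real.norm_of_nonneg (show 0 ≤ (m.factorial : ℝ) * Real.Gamma (m + (ν + 1)) by positivity),
      Real.norm_of_nonneg (by positivity)]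
  have h1 := hasSum_integral_of_summable_integral_norm hFi hs
  have h2 : HasSum (fun m => ∫ x in Set.Ioi (0 : ℝ), F m x)
      (j.factorial * laguerre j ν y * Real.exp (-y)) := by
    refine (hasSum_pow_mul_Gamma_div hν j y).congr_fun ?_
    intro m
    rw [← hint, ← integral_const_mul]
  rw [h2.unique h1]
  refine setIntegral_congr_fun measurableSet_Ioi fun x _ => ?_
  simp only [besselClifford, hF]
  rw [← mul_assoc, ← tsum_mul_left]
  refine tsum_congr fun m => ?_
  rw [pow_add, ← mul_neg, mul_pow]
  ring

theorem integrableOn_pow_mul_besselClifford {ν : ℝ} (hν : -1 < ν) (j : ℕ) {y : ℝ} (hy : 0 ≤ y) :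
    IntegrableOn
      (fun x : ℝ => x ^ ν * (x ^ j * Real.exp (-x) * besselClifford (ν + 1) (x * y)))
      (Set.Ioi 0) := by
  obtain ⟨C, hC0, hC⟩ := exists_abs_besselClifford_le (show 0 < ν + 1 by linarith)
  have h := ((integrableOn_rpow_mul_pow_mul_exp hν j).const_mul C).add
    ((integrableOn_rpow_mul_pow_mul_exp hν (j + 1)).const_mul (C * y))
  refine Integrable.mono' h ?_ ?_
  · have := continuous_besselClifford (show 0 < ν + 1 by linarith)
    refine ContinuousOn.aestronglyMeasurable (fun x hx => ?_) measurableSet_Ioi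
    refine ContinuousAt.continuousWithinAt ?_
    have h1 := Real.continuousAt_rpow_const x ν (Or.inl (ne_of_gt hx))
    refine h1.mul ?_
    fun_prop
  · filter_upwards [ae_restrict_mem measurableSet_Ioi] with x hx
    rw [Set.mem_Ioi] at hx
    rw [norm_mul, norm_mul, Real.norm_of_nonneg (by positivity),
      Real.norm_of_nonneg (by positivity), Real.norm_eq_abs]
    calc x ^ ν * (x ^ j * Real.exp (-x) * |besselClifford (ν + 1) (x * y)|)
        ≤ x ^ ν * (x ^ j * Real.exp (-x) * (C * (1 + x * y))) := by
          have := hC (x * y) (by positivity)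
          gcongr
      _ = _ := by simp only [Pi.add_apply]; rw [pow_succ]; ring

/-- The Laguerre functions are eigenfunctions of the Hankel-type transform with kernel
`besselClifford (ν + 1) (x * y)`. -/
theorem integral_laguerre_mul_besselClifford {ν : ℝ} (hν : -1 < ν) (s : ℕ) {y : ℝ} (hy : 0 ≤ y) :
    ∫ x in Set.Ioi (0 : ℝ),
        x ^ ν * (laguerre s ν (2 * x) * Real.exp (-x) * besselClifford (ν + 1) (x * y)) =
      (-1) ^ s * (laguerre s ν (2 * y) * Real.exp (-y)) := by
  rw [← mul_assoc, ← sum_laguerreCoeff_mul_laguerre hν, Finset.sum_mul]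
  have h : ∀ x : ℝ, x ^ ν * (laguerre s ν (2 * x) * Real.exp (-x) * besselClifford (ν + 1) (x * y))
      = ∑ j ∈ Finset.range (s + 1), laguerreCoeff s ν j * 2 ^ j *
        (x ^ ν * (x ^ j * Real.exp (-x) * besselClifford (ν + 1) (x * y))) := by
    intro x
    rw [laguerre_eq_sum, Finset.sum_mul, Finset.sum_mul, Finset.mul_sum]
    refine Finset.sum_congr rfl fun j _ => ?_
    rw [mul_pow]; ring
  simp_rw [h]
  rw [integral_finsetSum _ fun j _ => (integrableOn_pow_mul_besselClifford hν j hy).const_mul _]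
  refine Finset.sum_congr rfl fun j _ => ?_
  rw [integral_const_mul, integral_pow_mul_besselClifford hν]
  ring

/-! ### The differential equation of the Laguerre functions. -/

theorem laguerreCoeff_succ {ν : ℝ} (hν : -1 < ν) {s j : ℕ} (hj : j < s) :
    (j + 1) * (j + 1 + ν) * laguerreCoeff s ν (j + 1) = -(s - j) * laguerreCoeff s ν j := by
  have h1 := (Gamma_add_nat_pos hν j).ne'
  have h0 : (0 : ℝ) ≤ j := j.cast_nonneg
  have h3 : ν + j + 1 ≠ 0 := by linarith
  obtain ⟨d, rfl⟩ : ∃ d, s = j + 1 + d := ⟨s - (j + 1), by omega⟩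
  rw [laguerreCoeff, laguerreCoeff, Gamma_add_nat_succ hν j,
    show j + 1 + d - (j + 1) = d by omega, show j + 1 + d - j = d + 1 by omega,
    Nat.factorial_succ, Nat.factorial_succ]
  push_cast
  have h4 : (d : ℝ) + 1 ≠ 0 := by positivity
  have h5 : (j : ℝ) + 1 ≠ 0 := by positivity
  field_simp
  ring

theorem exists_deriv_laguerre {ν : ℝ} (hν : -1 < ν) (s : ℕ) :
    ∃ p q : ℝ → ℝ, (∀ t, HasDerivAt (laguerre s ν) (p t) t) ∧ (∀ t, HasDerivAt p (q t) t) ∧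
      ∀ t, t * q t + (ν + 1 - t) * p t + s * laguerre s ν t = 0 := by
  refine ⟨fun t => ∑ j ∈ Finset.range (s + 1), laguerreCoeff s ν j * (j * t ^ (j - 1)),
    fun t => ∑ j ∈ Finset.range (s + 1),
      laguerreCoeff s ν j * (j * (((j - 1 : ℕ) : ℝ) * t ^ (j - 1 - 1))), fun t => ?_, fun t => ?_,
    fun t => ?_⟩
  · have h : laguerre s ν = fun t => ∑ j ∈ Finset.range (s + 1), laguerreCoeff s ν j * t ^ j :=
      funext fun t => laguerre_eq_sum s ν t
    rw [h]
    exact HasDerivAt.fun_sum fun j _ => (hasDerivAt_pow j t).const_mul _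
  · exact HasDerivAt.fun_sum fun j _ => ((hasDerivAt_pow (j - 1) t).const_mul _).const_mul _
  · have h1 : ∀ j : ℕ, t * (laguerreCoeff s ν j * (j * (((j - 1 : ℕ) : ℝ) * t ^ (j - 1 - 1))))
        + (ν + 1) * (laguerreCoeff s ν j * (j * t ^ (j - 1)))
        = j * (j + ν) * laguerreCoeff s ν j * t ^ (j - 1) := by
      intro j
      rcases j with _ | _ | j
      · simp
      · simp [add_comm]
      · simp only [Nat.add_sub_cancel]; push_cast; ring
    have h2 : ∑ j ∈ Finset.range (s + 1), (j * (j + ν) * laguerreCoeff s ν j * t ^ (j - 1))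
        = ∑ j ∈ Finset.range (s + 1), -(s - j) * laguerreCoeff s ν j * t ^ j := by
      rw [Finset.sum_range_succ', Finset.sum_range_succ _ s]
      simp only [Nat.cast_zero, zero_mul, add_zero, sub_self, neg_zero, Nat.add_sub_cancel]
      refine Finset.sum_congr rfl fun j hj => ?_
      have := laguerreCoeff_succ hν (Finset.mem_range.1 hj)
      push_cast
      rw [this]
    have h3 : ∀ j : ℕ, t * (laguerreCoeff s ν j * (j * t ^ (j - 1)))
        = j * laguerreCoeff s ν j * t ^ j := by
      intro j
      rcases j with _ | j
      · simp
      · simp only [Nat.add_sub_cancel]; ring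
    rw [laguerre_eq_sum, sub_mul, Finset.mul_sum, Finset.mul_sum, Finset.mul_sum, Finset.mul_sum,
      ← add_sub_assoc, ← Finset.sum_add_distrib, Finset.sum_congr rfl fun j _ => h1 j, h2,
      Finset.sum_congr rfl fun j _ => h3 j, ← Finset.sum_sub_distrib, ← Finset.sum_add_distrib]
    refine Finset.sum_eq_zero fun j _ => by ring

/-- The Laguerre function `L_s^(ν)(2r) e^(-r)`. -/
def laguerreFun (s : ℕ) (ν r : ℝ) : ℝ := laguerre s ν (2 * r) * Real.exp (-r)

theorem exists_deriv_laguerreFun {ν : ℝ} (hν : -1 < ν) (s : ℕ) :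
    ∃ p q : ℝ → ℝ, (∀ r, HasDerivAt (laguerreFun s ν) (p r) r) ∧ (∀ r, HasDerivAt p (q r) r) ∧
      ∀ r, r * q r + (ν + 1) * p r - r * laguerreFun s ν r
        = -(2 * s + ν + 1) * laguerreFun s ν r := by
  obtain ⟨p, q, hp, hq, h⟩ := exists_deriv_laguerre hν s
  have h2 : ∀ r : ℝ, HasDerivAt (fun r : ℝ => 2 * r) 2 r := fun r => by
    simpa using (hasDerivAt_id r).const_mul 2
  have he : ∀ r : ℝ, HasDerivAt (fun r : ℝ => Real.exp (-r)) (-Real.exp (-r)) r := fun r => by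
    simpa using (hasDerivAt_neg r).exp
  refine ⟨fun r => (2 * p (2 * r) - laguerre s ν (2 * r)) * Real.exp (-r),
    fun r => (4 * q (2 * r) - 4 * p (2 * r) + laguerre s ν (2 * r)) * Real.exp (-r),
    fun r => ?_, fun r => ?_, fun r => ?_⟩
  · convert! ((hp (2 * r)).comp r (h2 r)).mul (he r) using 1
    simp only [Function.comp_apply]; ring
  · convert! ((((hq (2 * r)).comp r (h2 r)).const_mul 2).sub ((hp (2 * r)).comp r (h2 r))).mul
      (he r) using 1
    simp only [Function.comp_apply, Pi.sub_apply]; ring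
  · have := h (2 * r)
    simp only [laguerreFun]
    linear_combination (2 * Real.exp (-r)) * this

/-! ### Moment determinacy and completeness. -/

open ProbabilityTheory in
/-- Finite measures on the line with an exponential moment are determined by their moments. -/
theorem measure_ext_of_moments {ρ ρ' : Measure ℝ} [IsFiniteMeasure ρ] [IsFiniteMeasure ρ']
    {δ : ℝ} (hδ : 0 < δ) (h : Integrable (fun x => Real.exp (δ * |x|)) ρ)
    (h' : Integrable (fun x => Real.exp (δ * |x|)) ρ')
    (hm : ∀ n : ℕ, ∫ x, x ^ n ∂ρ = ∫ x, x ^ n ∂ρ') : ρ = ρ' := by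
  have hset : ∀ {σ : Measure ℝ}, Integrable (fun x => Real.exp (δ * |x|)) σ →
      Set.Ioo (-δ) δ ⊆ interior (integrableExpSet id σ) := by
    intro σ hσ
    refine interior_maximal (fun t ht => ?_) isOpen_Ioo
    refine hσ.mono' (by fun_prop) (Filter.Eventually.of_forall fun x => ?_)
    rw [Real.norm_of_nonneg (Real.exp_pos _).le]
    apply Real.exp_le_exp.2
    calc t * id x ≤ |t * x| := le_abs_self _
      _ = |t| * |x| := abs_mul _ _
      _ ≤ δ * |x| := by gcongr; exact (abs_lt.2 ⟨ht.1, ht.2⟩).le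
  -- The complex moment generating functions are analytic on this strip. Their Taylor coefficients
  -- at 0 are the moments, so they coincide on the strip, and on the imaginary axis they are the
  -- characteristic functions.
  set U : Set ℂ := {z | z.re ∈ Set.Ioo (-δ) δ} with hU
  have hUconv : IsPreconnected U :=
    ((convex_Ioo (-δ) δ).linear_preimage Complex.reLm).isPreconnected
  have han : ∀ {σ : Measure ℝ}, Integrable (fun x => Real.exp (δ * |x|)) σ →
      AnalyticOnNhd ℂ (complexMGF id σ) U := fun hσ =>
    analyticOnNhd_complexMGF.mono fun z hz => hset hσ hz
  have h0 : (0 : ℂ) ∈ U := by simp [hU, hδ]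
  have hder : ∀ n : ℕ, iteratedDeriv n (complexMGF id ρ) 0 = iteratedDeriv n (complexMGF id ρ') 0 := by
    intro n
    rw [iteratedDeriv_complexMGF (by simpa using hset h h0),
      iteratedDeriv_complexMGF (by simpa using hset h' h0)]
    have := congrArg (Complex.ofReal) (hm n)
    rw [← integral_complex_ofReal, ← integral_complex_ofReal] at this
    simpa using this
  have hev : complexMGF id ρ =ᶠ[nhds 0] complexMGF id ρ' := by
    have e1 := (han h 0 h0).hasFPowerSeriesAt
    have e2 := (han h' 0 h0).hasFPowerSeriesAt
    simp_rw [hder] at e1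
    have e3 := e1.sub e2
    rw [sub_self] at e3
    filter_upwards [e3.eventually_eq_zero] with z hz
    simpa [sub_eq_zero] using hz
  have hEq := (han h).eqOn_of_preconnected_of_eventuallyEq (han h') hUconv h0 hev
  refine Measure.ext_of_charFun ?_
  funext t
  rw [← complexMGF_id_mul_I, ← complexMGF_id_mul_I]
  exact hEq (by simp [hU, hδ])

theorem integral_withDensity_ofReal {μ : Measure ℝ} {f u : ℝ → ℝ} (hfm : AEStronglyMeasurable f μ)
    (huc : Continuous u) (hu : Integrable (fun x => f x * u x) μ) :
    Integrable u (μ.withDensity fun x => ENNReal.ofReal (f x)) ∧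
      Integrable (fun x => max (f x) 0 * u x) μ ∧
      ∫ x, u x ∂(μ.withDensity fun x => ENNReal.ofReal (f x)) = ∫ x, max (f x) 0 * u x ∂μ := by
  have h : Integrable (fun x => max (f x) 0 * u x) μ := by
    refine hu.mono ?_ (Filter.Eventually.of_forall fun x => ?_)
    · exact (hfm.aemeasurable.max aemeasurable_const).aestronglyMeasurable.mul
        huc.aestronglyMeasurable
    · rw [norm_mul, norm_mul, Real.norm_of_nonneg (le_max_right _ _)]
      gcongr
      exact max_le (Real.le_norm_self _) (norm_nonneg _)
  refine ⟨?_, h, ?_⟩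
  · rw [integrable_withDensity_iff_integrable_smul₀' hfm.aemeasurable.ennreal_ofReal (by simp)]
    simpa only [ENNReal.toReal_ofReal', smul_eq_mul] using h
  · rw [integral_withDensity_eq_integral_toReal_smul₀ hfm.aemeasurable.ennreal_ofReal (by simp)]
    simp only [ENNReal.toReal_ofReal', smul_eq_mul]

theorem abs_pow_le_mul_exp (n : ℕ) (x : ℝ) :
    |x| ^ n ≤ 2 ^ n * n.factorial * Real.exp (1 / 2 * |x|) := by
  have h1 := Real.pow_div_factorial_le_exp (1 / 2 * |x|) (by positivity) n
  rw [mul_pow, div_le_iff₀ (by positivity)] at h1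
  have h2 : (2 : ℝ) ^ n * ((1 / 2) ^ n * |x| ^ n) = |x| ^ n := by
    rw [← mul_assoc, ← mul_pow]; norm_num
  rw [← h2]
  have : (0 : ℝ) < 2 ^ n := by positivity
  nlinarith

/-- Completeness of the functions `x ^ n * exp (-|x|)`. -/
theorem ae_eq_zero_of_integral_mul_pow_mul_exp_eq_zero {μ : Measure ℝ} {H : ℝ → ℝ}
    (hH : Integrable (fun x => H x * Real.exp (-(|x| / 2))) μ)
    (hm : ∀ n : ℕ, ∫ x, H x * (x ^ n * Real.exp (-|x|)) ∂μ = 0) : H =ᵐ[μ] 0 := by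
  set f : ℝ → ℝ := fun x => H x * Real.exp (-|x|) with hf
  have hfe : Integrable (fun x => f x * Real.exp (1 / 2 * |x|)) μ := by
    refine hH.congr (Filter.Eventually.of_forall fun x => ?_)
    simp only [hf]
    rw [mul_assoc, ← Real.exp_add]
    congr 2; ring
  have hfm : AEStronglyMeasurable f μ := by
    have h1 := hfe.aestronglyMeasurable.mul
      (show AEStronglyMeasurable (fun x : ℝ => Real.exp (-(1 / 2 * |x|))) μ by fun_prop)
    refine h1.congr (Filter.Eventually.of_forall fun x => ?_)
    simp only [Pi.mul_apply]
    rw [mul_assoc, ← Real.exp_add]; simp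
  have hint : ∀ g : ℝ → ℝ, Continuous g → (∃ C, ∀ x, |g x| ≤ C * Real.exp (1 / 2 * |x|)) →
      Integrable (fun x => f x * g x) μ := by
    rintro g hg ⟨C, hC⟩
    refine (hfe.norm.const_mul C).mono' (hfm.mul hg.aestronglyMeasurable)
      (Filter.Eventually.of_forall fun x => ?_)
    rw [norm_mul (f x), norm_mul (f x), Real.norm_of_nonneg (Real.exp_pos _).le,
      Real.norm_eq_abs (g x)]
    linarith [mul_le_mul_of_nonneg_left (hC x) (norm_nonneg (f x))]
  have hpow : ∀ n : ℕ, ∃ C, ∀ x : ℝ, |x ^ n| ≤ C * Real.exp (1 / 2 * |x|) := fun n =>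
    ⟨_, fun x => by rw [abs_pow]; exact abs_pow_le_mul_exp n x⟩
  have hfi : Integrable f μ := by
    have := hint (fun _ => 1) continuous_const ⟨1, fun x => by
      simp⟩
    simpa using this
  have hmom := fun n : ℕ => hint (fun x => x ^ n) (by fun_prop) (hpow n)
  have hneg : ∀ u : ℝ → ℝ, Integrable (fun x => f x * u x) μ →
      Integrable (fun x => (-f x) * u x) μ := fun u hu => by
    simp only [neg_mul]
    exact hu.neg
  have hfn : AEStronglyMeasurable (fun x => -f x) μ := hfm.neg
  have hfin : IsFiniteMeasure (μ.withDensity fun x => ENNReal.ofReal (f x)) :=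
    isFiniteMeasure_withDensity_ofReal hfi.2
  have hfin' : IsFiniteMeasure (μ.withDensity fun x => ENNReal.ofReal (-f x)) :=
    isFiniteMeasure_withDensity_ofReal hfi.neg.2
  -- The positive and negative parts of H exp(-|x|) are densities of two finite measures with equal
  -- moments; the hypothesis supplies the exponential moment with δ = 1/2.
  have hEq := measure_ext_of_moments (show (0 : ℝ) < 1 / 2 by norm_num)
    (integral_withDensity_ofReal hfm (by fun_prop) hfe).1
    (integral_withDensity_ofReal hfn (by fun_prop) (hneg _ hfe)).1 fun n => by
      have h1 := integral_withDensity_ofReal hfm (by fun_prop) (hmom n)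
      have h2 := integral_withDensity_ofReal hfn (by fun_prop) (hneg _ (hmom n))
      rw [h1.2.2, h2.2.2, ← sub_eq_zero, ← integral_sub h1.2.1 h2.2.1]
      refine Eq.trans ?_ (hm n)
      refine integral_congr_ae (Filter.Eventually.of_forall fun x => ?_)
      simp only [hf]
      rw [← sub_mul, max_zero_sub_max_neg_zero_eq_self]
      ring
  rw [withDensity_eq_iff hfm.aemeasurable.ennreal_ofReal hfn.aemeasurable.ennreal_ofReal] at hEq
  · filter_upwards [hEq] with x hx
    have h1 : f x = 0 := by
      rcases lt_trichotomy (f x) 0 with h | h | h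
      · rw [ENNReal.ofReal_of_nonpos h.le, eq_comm, ENNReal.ofReal_eq_zero] at hx
        linarith
      · exact h
      · rw [ENNReal.ofReal_of_nonpos (p := -f x) (by linarith), ENNReal.ofReal_eq_zero] at hx
        linarith
    simpa [hf, (Real.exp_pos _).ne'] using h1
  · exact hfi.lintegral_lt_top.ne

/-! ### The rank one measure. -/

section RankOne

variable {k : ℝ}

theorem rankOne_index (hk : 0 ≤ k) : (rankOne k hk).index = k := by
  simp only [DunklDatum.index, rankOne]
  rw [Finset.sum_pair (by norm_num)]; ring

theorem rankOne_lam (hk : 0 ≤ k) : (rankOne k hk).lam = k - 1 / 2 := by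
  rw [DunklDatum.lam, rankOne_index]; simp; ring

theorem rankOne_regular_iff (hk : 0 ≤ k) (x : ℝ) : (rankOne k hk).Regular x ↔ x ≠ 0 := by
  simp [DunklDatum.Regular, rankOne]

theorem rankOne_weight (hk : 0 ≤ k) {x : ℝ} (hx : x ≠ 0) :
    (rankOne k hk).weight 1 x = |x| ^ (2 * k - 1) := by
  have hx' := abs_pos.2 hx
  simp only [DunklDatum.weight, rankOne]
  rw [Finset.prod_pair (by norm_num)]
  simp only [Real.norm_eq_abs, RCLike.inner_apply, conj_trivial, mul_one, mul_neg, abs_neg]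
  rw [← Real.rpow_add hx', ← Real.rpow_add hx']
  congr 1; ring

theorem integrable_of_even_of_integrableOn_Ioi {f : ℝ → ℝ} (hf : ∀ x, f (-x) = f x)
    (h : IntegrableOn f (Set.Ioi 0)) : Integrable f := by
  rw [← integrableOn_univ, ← Set.Iic_union_Ioi (a := (0 : ℝ)), integrableOn_union]
  refine ⟨?_, h⟩
  rw [← Measure.map_neg_eq_self (volume : Measure ℝ)]
  have m : MeasurableEmbedding fun x : ℝ => -x := (Homeomorph.neg ℝ).measurableEmbedding
  rw [m.integrableOn_map_iff]
  simp_rw [Function.comp_def, hf, Set.neg_preimage, Set.neg_Iic, neg_zero]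
  exact Iff.mpr integrableOn_Ici_iff_integrableOn_Ioi h

theorem integrable_abs_rpow_mul_exp {ν p : ℝ} (hν : -1 < ν) (hp : 0 < p) :
    Integrable fun x : ℝ => |x| ^ ν * Real.exp (-p * |x|) := by
  refine integrable_of_even_of_integrableOn_Ioi (by simp) ?_
  refine (integrableOn_rpow_mul_exp_neg_mul_rpow hν one_pos hp).congr_fun (fun x hx => ?_)
    measurableSet_Ioi
  simp [abs_of_pos (Set.mem_Ioi.1 hx)]

theorem ae_volume_ne_zero : ∀ᵐ x : ℝ, x ≠ 0 := by
  simp [ae_iff]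

/-- The normalized weight `|x|^(2k-1) / (2Γ(2k))` of the rank one measure for `a = 1`. -/
def rankOneDensity (k x : ℝ) : ℝ := (2 * Real.Gamma (2 * k))⁻¹ * |x| ^ (2 * k - 1)

theorem measurable_rankOneDensity : Measurable (rankOneDensity k) := by
  unfold rankOneDensity; fun_prop

theorem rankOneDensity_nonneg (hk : 0 < k) (x : ℝ) : 0 ≤ rankOneDensity k x := by
  have := Real.Gamma_pos_of_pos (show 0 < 2 * k by positivity)
  unfold rankOneDensity; positivity

theorem rankOneDensity_neg (x : ℝ) : rankOneDensity k (-x) = rankOneDensity k x := by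
  simp [rankOneDensity]

theorem rankOne_integral_weight (hk : 0 < k) :
    ∫ z : ℝ, Real.exp (-(‖z‖ ^ (1 : ℝ) / 1)) * (rankOne k hk.le).weight 1 z
      = 2 * Real.Gamma (2 * k) := by
  have h : ∫ z : ℝ, Real.exp (-(‖z‖ ^ (1 : ℝ) / 1)) * (rankOne k hk.le).weight 1 z
      = ∫ z : ℝ, (fun r : ℝ => Real.exp (-r) * r ^ (2 * k - 1)) |z| := by
    refine integral_congr_ae ?_
    filter_upwards [ae_volume_ne_zero] with z hz
    rw [rankOne_weight hk.le hz]; simp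
  rw [h, integral_comp_abs (f := fun r : ℝ => Real.exp (-r) * r ^ (2 * k - 1)),
    Real.Gamma_eq_integral (by positivity)]

theorem rankOne_measure (hk : 0 < k) : (rankOne k hk.le).measure 1 =
    volume.withDensity fun x => ENNReal.ofReal (rankOneDensity k x) := by
  refine withDensity_congr_ae ?_
  filter_upwards [ae_volume_ne_zero] with x hx
  rw [rankOne_integral_weight hk, rankOne_weight hk.le hx, rankOneDensity]

theorem integrable_rankOne_measure_iff {F : Type*} [NormedAddCommGroup F] [NormedSpace ℝ F]
    (hk : 0 < k) {f : ℝ → F} : Integrable f ((rankOne k hk.le).measure 1) ↔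
      Integrable fun x => rankOneDensity k x • f x := by
  rw [rankOne_measure hk, integrable_withDensity_iff_integrable_smul'
    measurable_rankOneDensity.ennreal_ofReal (by simp)]
  simp only [ENNReal.toReal_ofReal (rankOneDensity_nonneg hk _)]

theorem integral_rankOne_measure {F : Type*} [NormedAddCommGroup F] [NormedSpace ℝ F]
    (hk : 0 < k) (f : ℝ → F) : ∫ x, f x ∂(rankOne k hk.le).measure 1 =
      ∫ x, rankOneDensity k x • f x := by
  rw [rankOne_measure hk, integral_withDensity_eq_integral_toReal_smul
    measurable_rankOneDensity.ennreal_ofReal (by simp)]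
  simp only [ENNReal.toReal_ofReal (rankOneDensity_nonneg hk _)]

theorem integral_comp_abs_rankOne_measure (hk : 0 < k) (f : ℝ → ℝ) :
    ∫ x, f |x| ∂(rankOne k hk.le).measure 1 =
      (Real.Gamma (2 * k))⁻¹ * ∫ x in Set.Ioi (0 : ℝ), x ^ (2 * k - 1) * f x := by
  rw [integral_rankOne_measure hk]
  have h := integral_comp_abs (f := fun x => (2 * Real.Gamma (2 * k))⁻¹ * (x ^ (2 * k - 1) * f x))
  simp only [rankOneDensity, smul_eq_mul, mul_assoc]
  rw [h, integral_const_mul]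
  ring

theorem integral_odd_rankOne_measure {F : Type*} [NormedAddCommGroup F] [NormedSpace ℝ F]
    (hk : 0 < k) {f : ℝ → F} (hf : ∀ x, f (-x) = -f x) :
    ∫ x, f x ∂(rankOne k hk.le).measure 1 = 0 := by
  rw [integral_rankOne_measure hk]
  have h := integral_neg_eq_self (fun x => rankOneDensity k x • f x) volume
  simp only [hf, rankOneDensity_neg, smul_neg, integral_neg] at h
  have h2 : (2 : ℝ) • ∫ x, rankOneDensity k x • f x = 0 := by
    rw [two_smul]; nth_rewrite 1 [← h]; simp
  simpa using h2

theorem integrable_pow_mul_exp_rankOne_measure (hk : 0 < k) (n : ℕ) {p : ℝ} (hp : 0 < p) :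
    Integrable (fun x : ℝ => |x| ^ n * Real.exp (-p * |x|)) ((rankOne k hk.le).measure 1) := by
  rw [integrable_rankOne_measure_iff hk]
  have hn : (0 : ℝ) ≤ n := n.cast_nonneg
  have h := (integrable_abs_rpow_mul_exp (ν := 2 * k - 1 + n) (by linarith) hp).const_mul
    (2 * Real.Gamma (2 * k))⁻¹
  refine h.congr ?_
  filter_upwards [ae_volume_ne_zero] with x hx
  rw [Real.rpow_add (abs_pos.2 hx), Real.rpow_natCast, rankOneDensity, smul_eq_mul]
  ring

theorem isFiniteMeasureOnCompacts_rankOne_measure (hk : 0 < k) :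
    IsFiniteMeasureOnCompacts ((rankOne k hk.le).measure 1) := by
  refine ⟨fun {K} hK => ?_⟩
  obtain ⟨R, hR⟩ := hK.isBounded.exists_norm_le
  have h := (integrable_pow_mul_exp_rankOne_measure hk 0 one_pos).measure_norm_ge_lt_top
    (Real.exp_pos (-R))
  refine lt_of_le_of_lt (measure_mono fun x hx => ?_) h
  have := hR x hx
  rw [Real.norm_eq_abs] at this
  simp only [Set.mem_ofPred_eq, pow_zero, one_mul, Real.norm_eq_abs, Real.abs_exp,
    Real.exp_le_exp]
  linarith

theorem ae_rankOne_measure_ne_zero (hk : 0 < k) :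
    ∀ᵐ x ∂(rankOne k hk.le).measure 1, x ≠ 0 := by
  rw [rankOne_measure hk]
  exact (withDensity_absolutelyContinuous _ _).ae_le ae_volume_ne_zero

theorem isOpenPosMeasure_rankOne_measure (hk : 0 < k) :
    ((rankOne k hk.le).measure 1).IsOpenPosMeasure := by
  rw [rankOne_measure hk]
  refine Measure.AbsolutelyContinuous.isOpenPosMeasure (μ := volume)
    (withDensity_absolutelyContinuous' measurable_rankOneDensity.ennreal_ofReal.aemeasurable ?_)
  filter_upwards [ae_volume_ne_zero] with x hx
  have := Real.Gamma_pos_of_pos (show 0 < 2 * k by positivity)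
  have := abs_pos.2 hx
  simp only [ne_eq, ENNReal.ofReal_eq_zero, not_le, rankOneDensity]
  positivity

end RankOne

/-! ### The rank one Dunkl operator and its oscillator. -/

section RankOne

variable {k : ℝ}

/-- The rank one Dunkl operator `f' + k (f(x) - f(-x)) / x`. -/
def rankOneDunkl (k : ℝ) (f : ℝ → ℂ) (x : ℝ) : ℂ :=
  deriv f x + k * ((f x - f (-x)) / x)

theorem rankOne_dunklOp (hk : 0 ≤ k) (ξ : ℝ) (f : ℝ → ℂ) (x : ℝ) :
    (rankOne k hk).dunklOp ξ f x = ξ * rankOneDunkl k f x := by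
  simp only [DunklDatum.dunklOp, rankOne, rankOneDunkl]
  rw [Finset.sum_pair (by norm_num), reflection_real _ (by norm_num),
    reflection_real _ (by norm_num), fderiv_eq_smul_deriv]
  simp only [RCLike.inner_apply, conj_trivial, Complex.real_smul]
  push_cast
  simp only [mul_one, mul_neg, div_neg]
  ring

theorem rankOneDunkl_const_mul (c : ℂ) (f : ℝ → ℂ) :
    rankOneDunkl k (fun y => c * f y) = fun x => c * rankOneDunkl k f x := by
  funext x
  simp only [rankOneDunkl, deriv_const_mul_field]
  ring

theorem rankOne_dunklLaplacian (hk : 0 ≤ k) (f : ℝ → ℂ) (x : ℝ) :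
    (rankOne k hk).dunklLaplacian f x = rankOneDunkl k (rankOneDunkl k f) x := by
  have h : ∀ ξ : ℝ, (rankOne k hk).dunklOp ξ f = fun y => ξ * rankOneDunkl k f y :=
    fun ξ => funext fun y => rankOne_dunklOp hk ξ f y
  -- The unit vector of the chosen basis of ℝ is 1 or -1; only its square enters.
  have hb : ∀ i, ((stdOrthonormalBasis ℝ ℝ i : ℝ) : ℂ) * (stdOrthonormalBasis ℝ ℝ i : ℝ) = 1 := by
    intro i
    have := (stdOrthonormalBasis ℝ ℝ).orthonormal.1 i
    rw [Real.norm_eq_abs] at this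
    rw [← Complex.ofReal_mul, ← abs_mul_abs_self, this]; simp
  simp only [DunklDatum.dunklLaplacian, h, rankOne_dunklOp, rankOneDunkl_const_mul, ← mul_assoc,
    hb, one_mul]
  simp

/-- For even functions the difference term vanishes. The result is written as x times a radial
function, the form that `rankOneDunkl_odd` takes as input, so that the Laplacian is obtained by
alternating the two lemmas. -/
theorem rankOneDunkl_even {f : ℝ → ℂ} {g : ℝ → ℝ} {C : ℂ} (hf : ∀ y ≠ 0, f y = C * (g |y| : ℝ))
    {x p : ℝ} (hx : x ≠ 0) (hg : HasDerivAt g p |x|) :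
    rankOneDunkl k f x = C * ((x * (p / |x|) : ℝ) : ℂ) := by
  have hs : (SignType.sign x : ℝ) = x / |x| := by
    rw [eq_div_iff (abs_pos.2 hx).ne', sign_mul_abs]
  have h1 : HasDerivAt (fun y => C * ((g |y| : ℝ) : ℂ)) (C * ((p * (x / |x|) : ℝ) : ℂ)) x := by
    rw [← hs]
    exact ((hg.comp x (hasDerivAt_abs hx)).ofReal_comp).const_mul C
  have h2 : f =ᶠ[nhds x] fun y => C * ((g |y| : ℝ) : ℂ) := by
    filter_upwards [isOpen_ne.mem_nhds hx] with y hy using hf y hy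
  rw [rankOneDunkl, h2.deriv_eq, h1.deriv, hf x hx, hf (-x) (neg_ne_zero.2 hx), abs_neg]
  simp only [sub_self, zero_div, mul_zero, add_zero]
  congr 2; ring

theorem rankOneDunkl_odd {f : ℝ → ℂ} {g : ℝ → ℝ} {C : ℂ}
    (hf : ∀ y ≠ 0, f y = C * ((y * g |y| : ℝ) : ℂ))
    {x p : ℝ} (hx : x ≠ 0) (hg : HasDerivAt g p |x|) :
    rankOneDunkl k f x = C * (((1 + 2 * k) * g |x| + |x| * p : ℝ) : ℂ) := by
  have hs : x * (SignType.sign x : ℝ) = |x| := by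
    rw [mul_comm, sign_mul_self]
  have h1 : HasDerivAt (fun y => C * ((y * g |y| : ℝ) : ℂ)) (C * ((g |x| + |x| * p : ℝ) : ℂ)) x := by
    have := ((hasDerivAt_id x).mul (hg.comp x (hasDerivAt_abs hx))).ofReal_comp.const_mul C
    convert! this using 1
    simp only [id, Function.comp_apply]
    congr 2
    rw [← hs]; ring
  have h2 : f =ᶠ[nhds x] fun y => C * ((y * g |y| : ℝ) : ℂ) := by
    filter_upwards [isOpen_ne.mem_nhds hx] with y hy using hf y hy
  rw [rankOneDunkl, h2.deriv_eq, h1.deriv, hf x hx, hf (-x) (neg_ne_zero.2 hx), abs_neg]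
  have hx' : (x : ℂ) ≠ 0 := by exact_mod_cast hx
  push_cast
  field_simp
  ring

theorem rankOneDunkl_monomial {f : ℝ → ℂ} {C : ℂ} {m : ℕ} (hf : ∀ y ≠ 0, f y = C * (y : ℂ) ^ m)
    {x : ℝ} (hx : x ≠ 0) :
    rankOneDunkl k f x = C * ((m + k * (1 - (-1) ^ m) : ℝ) : ℂ) * (x : ℂ) ^ (m - 1) := by
  have h1 : HasDerivAt (fun y : ℝ => C * (y : ℂ) ^ m) (C * (m * (x : ℂ) ^ (m - 1))) x := by
    have h := ((hasDerivAt_id x).ofReal_comp.pow m).const_mul C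
    simpa using h
  have h2 : f =ᶠ[nhds x] fun y : ℝ => C * (y : ℂ) ^ m := by
    filter_upwards [isOpen_ne.mem_nhds hx] with y hy using hf y hy
  have hx' : (x : ℂ) ≠ 0 := by exact_mod_cast hx
  rw [rankOneDunkl, h2.deriv_eq, h1.deriv, hf x hx, hf (-x) (neg_ne_zero.2 hx)]
  push_cast
  rw [neg_pow]
  rcases m with _ | m
  · simp
  · rw [Nat.add_sub_cancel, pow_succ (x : ℂ)]
    push_cast
    field_simp

theorem rankOneDunkl_rankOneDunkl_monomial {f : ℝ → ℂ} {C : ℂ} {m : ℕ}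
    (hf : ∀ y ≠ 0, f y = C * (y : ℂ) ^ m) {x : ℝ} (hx : x ≠ 0) :
    rankOneDunkl k (rankOneDunkl k f) x = C * ((m + k * (1 - (-1) ^ m) : ℝ) : ℂ) *
      (((m - 1 : ℕ) + k * (1 - (-1) ^ (m - 1)) : ℝ) : ℂ) * (x : ℂ) ^ (m - 1 - 1) :=
  rankOneDunkl_monomial (fun _ hy => rankOneDunkl_monomial hf hy) hx

theorem rankOne_isHarmonic_pow (hk : 0 ≤ k) {n : ℕ} (hn : n ≤ 1) :
    (rankOne k hk).IsHarmonic n fun x => (x : ℂ) ^ n := by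
  refine ⟨⟨(MultilinearMap.mkPiAlgebra ℝ (Fin n) ℂ).compLinearMap
    fun _ => Complex.ofRealCLM.toLinearMap, fun x => by simp⟩, fun x hx => ?_⟩
  rw [rankOne_regular_iff] at hx
  rw [rankOne_dunklLaplacian,
    rankOneDunkl_rankOneDunkl_monomial (C := 1) (m := n) (fun y _ => by rw [one_mul]) hx]
  interval_cases n <;> simp

theorem rankOne_isHarmonic_eq (hk : 0 ≤ k) {n : ℕ} {h : ℝ → ℂ}
    (hh : (rankOne k hk).IsHarmonic n h) (x : ℝ) : h x = h 1 * (x : ℂ) ^ n := by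
  obtain ⟨⟨m, hm⟩, -⟩ := hh
  have h1 := m.map_smul_univ (fun _ => x) (fun _ => 1)
  simp only [smul_eq_mul, mul_one, Finset.prod_const, Finset.card_univ, Fintype.card_fin] at h1
  rw [hm, hm 1, h1, Complex.real_smul]
  push_cast; ring

/-- The square of the Dunkl operator multiplies x^n by a coefficient and lowers the degree by two;
for n ≥ 2 and k ≥ 0 both factors of the coefficient are positive. -/
theorem rankOne_isHarmonic_eq_zero (hk : 0 ≤ k) {n : ℕ} (hn : 2 ≤ n) {h : ℝ → ℂ}
    (hh : (rankOne k hk).IsHarmonic n h) : h 1 = 0 := by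
  have h1 := hh.2 1 ((rankOne_regular_iff hk 1).2 one_ne_zero)
  rw [rankOne_dunklLaplacian, rankOneDunkl_rankOneDunkl_monomial (C := h 1) (m := n)
    (fun y _ => rankOne_isHarmonic_eq hk hh y) one_ne_zero] at h1
  have hpos : ∀ m : ℕ, 0 < m → ((m : ℝ) + k * (1 - (-1) ^ m)) ≠ 0 := by
    intro m hm
    have h3 : (0 : ℝ) ≤ 1 - (-1) ^ m := by
      rcases neg_one_pow_eq_or ℝ m with h | h <;> rw [h] <;> norm_num
    have h4 : (0 : ℝ) < m := by exact_mod_cast hm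
    have := mul_nonneg hk h3
    positivity
  have a1 := hpos n (by omega)
  have a2 := hpos (n - 1) (by omega)
  have b1 := Complex.ofReal_ne_zero.2 a1
  have b2 := Complex.ofReal_ne_zero.2 a2
  simpa only [Complex.ofReal_one, one_pow, mul_one, mul_eq_zero, b1, b2, or_false] using h1

/-- The eigenfunction `x ^ n L_s^(2k-1+2n)(2|x|) e^(-|x|)`. -/
def rankOneEigen (k : ℝ) (n s : ℕ) (x : ℝ) : ℝ := x ^ n * laguerreFun s (2 * k - 1 + 2 * n) |x|

theorem rankOne_eigenfun (hk : 0 ≤ k) {n : ℕ} (s : ℕ) {h : ℝ → ℂ}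
    (hh : (rankOne k hk).IsHarmonic n h) (x : ℝ) :
    (rankOne k hk).eigenfun 1 n s h x = h 1 * (rankOneEigen k n s x : ℝ) := by
  rw [DunklDatum.eigenfun, rankOne_isHarmonic_eq hk hh x, rankOne_lam, rankOneEigen, laguerreFun]
  rw [show 2 * (k - 1 / 2 + (n : ℝ)) / 1 = 2 * k - 1 + 2 * n by ring]
  simp only [Real.rpow_one, div_one, Real.norm_eq_abs]
  push_cast; ring

/-- In r = |x| the eigenvalue equation reduces to that of the Laguerre function with ν + 1 = 2k for
n = 0 and ν + 1 = 2k + 2 for n = 1. -/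
theorem rankOne_oscillator_eigenfun (hk : 0 < k) {n : ℕ} (hn : n ≤ 1) (s : ℕ) {h : ℝ → ℂ}
    (hh : (rankOne k hk.le).IsHarmonic n h) {x : ℝ} (hx : x ≠ 0) :
    (rankOne k hk.le).oscillator 1 ((rankOne k hk.le).eigenfun 1 n s h) x =
      ((-(2 * s + 2 * n + 2 * k) : ℝ) : ℂ) * (rankOne k hk.le).eigenfun 1 n s h x := by
  have hn0 : (0 : ℝ) ≤ n := n.cast_nonneg
  obtain ⟨p, q, hp, hq, heq⟩ := exists_deriv_laguerreFun
    (show -1 < 2 * k - 1 + 2 * n by linarith) s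
  set g := laguerreFun s (2 * k - 1 + 2 * n) with hg
  have hfun : (rankOne k hk.le).eigenfun 1 n s h
      = fun x => h 1 * ((x ^ n * g |x| : ℝ) : ℂ) :=
    funext fun x => rankOne_eigenfun hk.le s hh x
  rw [DunklDatum.oscillator, rankOne_dunklLaplacian, hfun, show (2 - 1 : ℝ) = 1 by norm_num]
  simp only [Real.rpow_one, Real.norm_eq_abs]
  have hr : |x| ≠ 0 := (abs_pos.2 hx).ne'
  have hE := heq |x|
  interval_cases n
  · rw [rankOneDunkl_odd (g := fun r => p r / r) (C := h 1)
      (p := (q |x| * |x| - p |x| * 1) / |x| ^ 2)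
      (fun y hy => rankOneDunkl_even (g := g) (C := h 1) (fun z _ => by simp) hy (hp _)) hx
      ((hq _).div (hasDerivAt_id _) hr)]
    have : |x| * ((1 + 2 * k) * (p |x| / |x|) + |x| * ((q |x| * |x| - p |x| * 1) / |x| ^ 2))
        - |x| * g |x| = -(2 * s + 2 * k) * g |x| := by
      have h2 : |x| * ((1 + 2 * k) * (p |x| / |x|) + |x| * ((q |x| * |x| - p |x| * 1) / |x| ^ 2))
        = |x| * q |x| + 2 * k * p |x| := by field_simp; ring
      rw [h2]; push_cast at hE; linear_combination hE
    have hc := congrArg Complex.ofReal this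
    push_cast at hc ⊢
    linear_combination h 1 * hc
  · rw [rankOneDunkl_even (g := fun r => (1 + 2 * k) * g r + r * p r) (C := h 1)
      (p := (1 + 2 * k) * p |x| + (1 * p |x| + |x| * q |x|))
      (fun y hy => rankOneDunkl_odd (g := g) (C := h 1) (fun z _ => by simp) hy (hp _)) hx
      (((hp _).const_mul _).add ((hasDerivAt_id _).mul (hq _)))]
    have : |x| * (x * (((1 + 2 * k) * p |x| + (1 * p |x| + |x| * q |x|)) / |x|))
        - |x| * (x * g |x|) = -(2 * s + 2 + 2 * k) * (x * g |x|) := by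
      have h2 : |x| * (x * (((1 + 2 * k) * p |x| + (1 * p |x| + |x| * q |x|)) / |x|))
        = x * (|x| * q |x| + (2 * k + 2) * p |x|) := by field_simp; ring
      rw [h2]; push_cast at hE; linear_combination x * hE
    have hc := congrArg Complex.ofReal this
    push_cast at hc ⊢
    linear_combination h 1 * hc

end RankOne

/-! ### Exponentially decaying functions. -/

/-- Continuous functions that decay like `exp (-|x|/2)`. -/
structure ExpDecay {F : Type*} [NormedAddCommGroup F] (f : ℝ → F) : Prop where
  continuous : Continuous f
  bound : ∃ C, 0 ≤ C ∧ ∀ x, ‖f x‖ ≤ C * Real.exp (-(1 / 2) * |x|)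

section ExpDecay

variable {k : ℝ} {F : Type*} [NormedAddCommGroup F] [NormedSpace ℝ F]

theorem ExpDecay.ofReal {f : ℝ → ℝ} (hf : ExpDecay f) : ExpDecay fun x => (f x : ℂ) :=
  ⟨Complex.continuous_ofReal.comp hf.continuous, by simpa using hf.bound⟩

theorem expDecay_of_hasCompactSupport {f : ℝ → F} (hf : Continuous f) (hs : HasCompactSupport f) :
    ExpDecay f := by
  refine ⟨hf, ?_⟩
  have hc : Continuous fun x => Real.exp (1 / 2 * |x|) • f x := by fun_prop
  obtain ⟨C, hC⟩ := hc.bounded_above_of_compact_support (hs.smul_left)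
  refine ⟨C, (norm_nonneg _).trans (hC 0), fun x => ?_⟩
  have h := hC x
  rw [norm_smul, Real.norm_of_nonneg (Real.exp_pos _).le] at h
  rw [neg_mul, Real.exp_neg, ← div_eq_mul_inv, le_div_iff₀ (Real.exp_pos _)]
  linarith

theorem expDecay_pow_mul_abs_pow_mul_exp (n j : ℕ) :
    ExpDecay fun x : ℝ => x ^ n * (|x| ^ j * Real.exp (-|x|)) := by
  refine ⟨by fun_prop, 2 ^ (n + j) * (n + j).factorial, by positivity, fun x => ?_⟩
  have h := abs_pow_le_mul_exp (n + j) x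
  rw [norm_mul, norm_mul, norm_pow, norm_pow, Real.norm_eq_abs, Real.norm_eq_abs, abs_abs,
    Real.norm_of_nonneg (Real.exp_pos _).le, ← mul_assoc, ← pow_add]
  calc |x| ^ (n + j) * Real.exp (-|x|)
      ≤ 2 ^ (n + j) * (n + j).factorial * Real.exp (1 / 2 * |x|) * Real.exp (-|x|) := by gcongr
    _ = _ := by
      rw [mul_assoc _ (Real.exp _), ← Real.exp_add]
      congr 2; ring

theorem ExpDecay.const_mul {f : ℝ → ℝ} (hf : ExpDecay f) (c : ℝ) : ExpDecay fun x => c * f x := by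
  obtain ⟨C, hC0, hC⟩ := hf.bound
  refine ⟨hf.continuous.const_mul c, |c| * C, by positivity, fun x => ?_⟩
  rw [norm_mul, Real.norm_eq_abs, mul_assoc]
  gcongr
  exact hC x

theorem ExpDecay.sum {ι : Type*} {s : Finset ι} {f : ι → ℝ → ℝ} (hf : ∀ i ∈ s, ExpDecay (f i)) :
    ExpDecay fun x => ∑ i ∈ s, f i x := by
  classical
  induction s using Finset.induction_on with
  | empty => exact ⟨by simp [continuous_const], 0, le_rfl, by simp⟩
  | insert a s ha ih =>
    obtain ⟨h1, C1, hC1, hb1⟩ := hf a (Finset.mem_insert_self a s)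
    obtain ⟨h2, C2, hC2, hb2⟩ := ih fun i hi => hf i (Finset.mem_insert_of_mem hi)
    simp only [Finset.sum_insert ha]
    refine ⟨h1.add h2, C1 + C2, by positivity, fun x => (norm_add_le _ _).trans ?_⟩
    rw [add_mul]
    exact add_le_add (hb1 x) (hb2 x)

theorem rankOneEigen_eq_sum (k : ℝ) (n s : ℕ) (x : ℝ) : rankOneEigen k n s x =
    ∑ j ∈ Finset.range (s + 1), laguerreCoeff s (2 * k - 1 + 2 * n) j * 2 ^ j *
      (x ^ n * (|x| ^ j * Real.exp (-|x|))) := by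
  rw [rankOneEigen, laguerreFun, laguerre_eq_sum, Finset.sum_mul, Finset.mul_sum]
  refine Finset.sum_congr rfl fun j _ => ?_
  rw [mul_pow]; ring

theorem expDecay_rankOneEigen (k : ℝ) (n s : ℕ) : ExpDecay (rankOneEigen k n s) := by
  rw [funext (rankOneEigen_eq_sum k n s)]
  exact ExpDecay.sum fun j _ => (expDecay_pow_mul_abs_pow_mul_exp n j).const_mul _

theorem ExpDecay.integrable_smul (hk : 0 < k) {f : ℝ → F} (hf : ExpDecay f) {φ : ℝ → ℝ}
    (hφm : AEStronglyMeasurable φ ((rankOne k hk.le).measure 1))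
    {C : ℝ} (hφ : ∀ x, |φ x| ≤ C * (1 + |x|)) :
    Integrable (fun x => φ x • f x) ((rankOne k hk.le).measure 1) := by
  obtain ⟨C', hC', hb⟩ := hf.bound
  have h0 := integrable_pow_mul_exp_rankOne_measure hk 0 (show (0 : ℝ) < 1 / 2 by norm_num)
  have h1 := integrable_pow_mul_exp_rankOne_measure hk 1 (show (0 : ℝ) < 1 / 2 by norm_num)
  refine ((h0.add h1).const_mul (C * C')).mono'
    (hφm.smul hf.continuous.aestronglyMeasurable) (Filter.Eventually.of_forall fun x => ?_)
  rw [norm_smul, Real.norm_eq_abs]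
  calc |φ x| * ‖f x‖ ≤ (C * (1 + |x|)) * (C' * Real.exp (-(1 / 2) * |x|)) :=
        mul_le_mul (hφ x) (hb x) (norm_nonneg _) ((abs_nonneg _).trans (hφ x))
    _ = _ := by simp only [Pi.add_apply]; ring

theorem ExpDecay.memLp_two {F : Type*} [NormedAddCommGroup F] (hk : 0 < k) {f : ℝ → F} (hf : ExpDecay f) :
    MemLp f 2 ((rankOne k hk.le).measure 1) := by
  rw [memLp_two_iff_integrable_sq_norm hf.continuous.aestronglyMeasurable]
  obtain ⟨C, hC, hb⟩ := hf.bound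
  have h0 := integrable_pow_mul_exp_rankOne_measure hk 0 one_pos
  refine (h0.const_mul (C ^ 2)).mono' (by have := hf.continuous; fun_prop)
    (Filter.Eventually.of_forall fun x => ?_)
  rw [norm_pow, norm_norm]
  calc ‖f x‖ ^ 2 ≤ (C * Real.exp (-(1 / 2) * |x|)) ^ 2 := by gcongr; exact hb x
    _ = _ := by
      rw [mul_pow, ← Real.exp_nat_mul, pow_zero, one_mul]
      congr 2; push_cast; ring

end ExpDecay

/-! ### The kernel and its integral transform. -/

section Kernel

variable {k : ℝ}

/-- The kernel `B_{k,1}` on the line. -/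
def rankOneKernel (k x y : ℝ) : ℝ := Real.Gamma (2 * k) *
  (besselClifford (2 * k) |x * y| - x * y * besselClifford (2 * k + 2) |x * y|)

theorem rankOneKernel_comm (x y : ℝ) : rankOneKernel k x y = rankOneKernel k y x := by
  rw [rankOneKernel, rankOneKernel, mul_comm x y]

theorem rankOneKernel_zero (hk : 0 < k) (y : ℝ) : rankOneKernel k 0 y = 1 := by
  have := Real.Gamma_pos_of_pos (show 0 < 2 * k by positivity)
  rw [rankOneKernel]
  simp only [zero_mul, abs_zero, sub_zero, besselClifford_zero]
  field_simp

theorem continuous_rankOneKernel (hk : 0 < k) :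
    Continuous fun p : ℝ × ℝ => rankOneKernel k p.1 p.2 := by
  have h1 := continuous_besselClifford (show 0 < 2 * k by positivity)
  have h2 := continuous_besselClifford (show 0 < 2 * k + 2 by positivity)
  unfold rankOneKernel
  fun_prop

/-- The even and odd parts are bounded separately because the eigenfunction computation splits the
integral. The product form of the bound is what Fubini needs. -/
theorem exists_rankOneKernel_parts_le (hk : 0 < k) : ∃ C, 0 ≤ C ∧ ∀ x y,
    |besselClifford (2 * k) (|x * y|)| ≤ C * (1 + |x|) * (1 + |y|) ∧
    |x * y * besselClifford (2 * k + 2) (|x * y|)| ≤ C * (1 + |x|) * (1 + |y|) := by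
  obtain ⟨C1, h1, hb1⟩ := exists_abs_besselClifford_le (show 0 < 2 * k by positivity)
  have hΓ := Real.Gamma_pos_of_pos (show 0 < 2 * k + 2 by positivity)
  refine ⟨C1 + 1 / Real.Gamma (2 * k + 2), by positivity, fun x y => ?_⟩
  have hx := abs_nonneg x
  have hy := abs_nonneg y
  have hxy : 1 + |x * y| ≤ (1 + |x|) * (1 + |y|) := by rw [abs_mul]; nlinarith
  have h0 := abs_nonneg (x * y)
  constructor
  · calc |besselClifford (2 * k) (|x * y|)| ≤ C1 * (1 + |x * y|) := hb1 _ h0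
      _ ≤ (C1 + 1 / Real.Gamma (2 * k + 2)) * ((1 + |x|) * (1 + |y|)) := by
        gcongr
        exact le_add_of_nonneg_right (by positivity)
      _ = _ := by ring
  · rw [abs_mul]
    calc |x * y| * |besselClifford (2 * k + 2) (|x * y|)|
        ≤ (1 + |x * y|) * (1 / Real.Gamma (2 * k + 2)) := by
          gcongr
          · linarith
          · exact abs_besselClifford_le (by linarith) h0
      _ ≤ ((1 + |x|) * (1 + |y|)) * (C1 + 1 / Real.Gamma (2 * k + 2)) := by
        gcongr
        exact le_add_of_nonneg_left h1
      _ = _ := by ring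

theorem exists_rankOneKernel_le (hk : 0 < k) : ∃ C, 0 ≤ C ∧ ∀ x y,
    |rankOneKernel k x y| ≤ C * (1 + |x|) * (1 + |y|) := by
  obtain ⟨C, hC, hb⟩ := exists_rankOneKernel_parts_le hk
  have hΓ := Real.Gamma_pos_of_pos (show 0 < 2 * k by positivity)
  refine ⟨Real.Gamma (2 * k) * (2 * C), by positivity, fun x y => ?_⟩
  rw [rankOneKernel, abs_mul, abs_of_pos hΓ]
  have h := abs_sub (besselClifford (2 * k) |x * y|) (x * y * besselClifford (2 * k + 2) |x * y|)
  have := hb x y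
  calc _ ≤ Real.Gamma (2 * k) * (2 * (C * (1 + |x|) * (1 + |y|))) := by gcongr; linarith
    _ = _ := by ring

/-- The eigenfunctions of the oscillator are eigenfunctions of the integral transform. -/
theorem integral_rankOneKernel_mul_rankOneEigen (hk : 0 < k) {n : ℕ} (hn : n ≤ 1) (s : ℕ) (y : ℝ) :
    ∫ x, rankOneKernel k y x * rankOneEigen k n s x ∂(rankOne k hk.le).measure 1 =
      (-1) ^ (n + s) * rankOneEigen k n s y := by
  obtain ⟨C, hC, hb⟩ := exists_rankOneKernel_parts_le hk
  have hΓ := Real.Gamma_pos_of_pos (show 0 < 2 * k by positivity)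
  have hc1 := continuous_besselClifford (show 0 < 2 * k by positivity)
  have hc2 := continuous_besselClifford (show 0 < 2 * k + 2 by positivity)
  have i1 : Integrable (fun x => besselClifford (2 * k) |y * x| * rankOneEigen k n s x)
      ((rankOne k hk.le).measure 1) :=
    (expDecay_rankOneEigen k n s).integrable_smul hk (by fun_prop) fun x => (hb y x).1
  have i2 : Integrable (fun x => y * x * besselClifford (2 * k + 2) |y * x| * rankOneEigen k n s x)
      ((rankOne k hk.le).measure 1) :=
    (expDecay_rankOneEigen k n s).integrable_smul hk (by fun_prop) fun x => (hb y x).2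
  have hsplit : ∫ x, rankOneKernel k y x * rankOneEigen k n s x ∂(rankOne k hk.le).measure 1
      = Real.Gamma (2 * k) * (
        ∫ x, besselClifford (2 * k) |y * x| * rankOneEigen k n s x ∂(rankOne k hk.le).measure 1 -
        ∫ x, y * x * besselClifford (2 * k + 2) |y * x| * rankOneEigen k n s x
          ∂(rankOne k hk.le).measure 1) := by
    rw [← integral_sub i1 i2, ← integral_const_mul]
    congr 1; funext x; rw [rankOneKernel]; ring
  rw [hsplit]
  have hodd := fun f hf => integral_odd_rankOne_measure (F := ℝ) hk (f := f) hf
  have hy := abs_nonneg y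
  -- Parity kills one half of the kernel. For n = 1 the factor x² raises the exponent 2k-1 of the
  -- weight to 2k+1, the one belonging to the Hankel transform of that order.
  interval_cases n
  · rw [hodd (fun x => y * x * besselClifford (2 * k + 2) |y * x| * rankOneEigen k 0 s x)
      (fun x => by simp [rankOneEigen])]
    have he := integral_comp_abs_rankOne_measure hk
      (fun r => besselClifford (2 * k) (r * |y|) * laguerreFun s (2 * k - 1) r)
    have hL := integral_laguerre_mul_besselClifford (show -1 < 2 * k - 1 by linarith) s hy
    have e1 : ∀ x, besselClifford (2 * k) |y * x| * rankOneEigen k 0 s x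
        = besselClifford (2 * k) (|x| * |y|) * laguerreFun s (2 * k - 1) |x| := fun x => by
      rw [rankOneEigen, abs_mul, mul_comm |y|]; simp
    simp_rw [e1]
    rw [he]
    rw [sub_add_cancel] at hL
    have e2 : ∫ x in Set.Ioi (0 : ℝ), x ^ (2 * k - 1) *
        (besselClifford (2 * k) (x * |y|) * laguerreFun s (2 * k - 1) x)
        = (-1) ^ s * laguerreFun s (2 * k - 1) |y| := by
      rw [laguerreFun, ← hL]
      congr 1; funext x; rw [laguerreFun]; ring
    rw [e2, rankOneEigen]
    simp only [pow_zero, Nat.cast_zero, mul_zero, add_zero, zero_add, one_mul, sub_zero]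
    field_simp
  · rw [hodd (fun x => besselClifford (2 * k) |y * x| * rankOneEigen k 1 s x)
      (fun x => by simp [rankOneEigen])]
    have he := integral_comp_abs_rankOne_measure hk
      (fun r => r ^ 2 * (besselClifford (2 * k + 2) (r * |y|) * laguerreFun s (2 * k + 1) r))
    have hL := integral_laguerre_mul_besselClifford (show -1 < 2 * k + 1 by linarith) s hy
    have e0 : 2 * k - 1 + 2 * ((1 : ℕ) : ℝ) = 2 * k + 1 := by push_cast; ring
    have e1 : ∀ x, y * x * besselClifford (2 * k + 2) |y * x| * rankOneEigen k 1 s x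
        = y * (|x| ^ 2 * (besselClifford (2 * k + 2) (|x| * |y|) *
          laguerreFun s (2 * k + 1) |x|)) := fun x => by
      rw [rankOneEigen, abs_mul, mul_comm |y|, e0, sq_abs]; ring
    simp_rw [e1]
    rw [integral_const_mul, he]
    have e2 : ∫ x in Set.Ioi (0 : ℝ), x ^ (2 * k - 1) * (x ^ 2 *
        (besselClifford (2 * k + 2) (x * |y|) * laguerreFun s (2 * k + 1) x))
        = (-1) ^ s * laguerreFun s (2 * k + 1) |y| := by
      rw [laguerreFun, ← hL]
      refine setIntegral_congr_fun measurableSet_Ioi fun x hx => ?_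
      have e3 : x ^ (2 * k + 1) = x ^ (2 * k - 1) * x ^ 2 := by
        rw [← Real.rpow_natCast, ← Real.rpow_add hx]; congr 1; push_cast; ring
      simp only [laguerreFun]
      rw [e3, show 2 * k + 1 + 1 = 2 * k + 2 by ring]; ring
    rw [e2, rankOneEigen, e0, pow_add]
    field_simp
    ring

/-- The integral transform with kernel `rankOneKernel`. -/
def rankOneTransform (hk : 0 < k) (f : ℝ → ℂ) (y : ℝ) : ℂ :=
  ∫ x, (rankOneKernel k y x : ℂ) * f x ∂(rankOne k hk.le).measure 1

theorem rankOneTransform_rankOneEigen (hk : 0 < k) {n : ℕ} (hn : n ≤ 1) (s : ℕ) (y : ℝ) :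
    rankOneTransform hk (fun x => (rankOneEigen k n s x : ℂ)) y =
      (-1) ^ (n + s) * (rankOneEigen k n s y : ℂ) := by
  have h := congrArg Complex.ofReal (integral_rankOneKernel_mul_rankOneEigen hk hn s y)
  rw [← integral_complex_ofReal] at h
  push_cast at h
  exact h

theorem exists_norm_rankOneTransform_le (hk : 0 < k) {f : ℝ → ℂ} (hf : ExpDecay f) :
    ∃ C, ∀ y, ‖rankOneTransform hk f y‖ ≤ C * (1 + |y|) := by
  obtain ⟨C, hC, hb⟩ := exists_rankOneKernel_le hk
  have hi : Integrable (fun x => (1 + |x|) • f x) ((rankOne k hk.le).measure 1) :=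
    hf.integrable_smul hk (by fun_prop) (C := 1) fun x => by
      rw [abs_of_nonneg (by positivity), one_mul]
  refine ⟨C * ∫ x, ‖(1 + |x|) • f x‖ ∂(rankOne k hk.le).measure 1, fun y => ?_⟩
  rw [mul_right_comm, ← integral_const_mul]
  refine norm_integral_le_of_norm_le (hi.norm.const_mul _) (Filter.Eventually.of_forall fun x => ?_)
  rw [norm_mul, Complex.norm_real, norm_smul, Real.norm_eq_abs,
    Real.norm_of_nonneg (show 0 ≤ 1 + |x| by positivity), ← mul_assoc]
  gcongr
  exact hb y x

theorem aestronglyMeasurable_rankOneTransform (hk : 0 < k) {f : ℝ → ℂ} (hf : Continuous f) :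
    AEStronglyMeasurable (rankOneTransform hk f) ((rankOne k hk.le).measure 1) := by
  have := isFiniteMeasureOnCompacts_rankOne_measure hk
  have h : Continuous fun p : ℝ × ℝ => (rankOneKernel k p.1 p.2 : ℂ) * f p.2 :=
    (Complex.continuous_ofReal.comp (continuous_rankOneKernel hk)).mul (hf.comp continuous_snd)
  have h2 : AEStronglyMeasurable (fun p : ℝ × ℝ => (rankOneKernel k p.1 p.2 : ℂ) * f p.2)
      (((rankOne k hk.le).measure 1).prod ((rankOne k hk.le).measure 1)) :=
    h.aestronglyMeasurable
  exact h2.integral_prod_right'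

theorem ExpDecay.integrable_mul_rankOneTransform (hk : 0 < k) {f g : ℝ → ℂ} (hf : ExpDecay f)
    (hg : ExpDecay g) :
    Integrable (fun y => g y * rankOneTransform hk f y) ((rankOne k hk.le).measure 1) := by
  obtain ⟨C, hC⟩ := exists_norm_rankOneTransform_le hk hf
  have h := (hg.integrable_smul hk (φ := fun x => C * (1 + |x|)) (by fun_prop) (C := |C|)
    fun x => by rw [abs_mul, abs_of_nonneg (show 0 ≤ 1 + |x| by positivity)])
  refine h.mono (hg.continuous.aestronglyMeasurable.mul
    (aestronglyMeasurable_rankOneTransform hk hf.continuous)) (Filter.Eventually.of_forall fun y => ?_)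
  rw [norm_mul, norm_smul, mul_comm]
  gcongr
  exact (hC y).trans (Real.le_norm_self _)

/-- The integral transform is symmetric. -/
theorem integral_mul_rankOneTransform (hk : 0 < k) {f g : ℝ → ℂ} (hf : ExpDecay f)
    (hg : ExpDecay g) :
    ∫ y, g y * rankOneTransform hk f y ∂(rankOne k hk.le).measure 1 =
      ∫ x, rankOneTransform hk g x * f x ∂(rankOne k hk.le).measure 1 := by
  have := isFiniteMeasureOnCompacts_rankOne_measure hk
  obtain ⟨C, hC, hb⟩ := exists_rankOneKernel_le hk
  have hi : ∀ {f : ℝ → ℂ}, ExpDecay f →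
      Integrable (fun x => (1 + |x|) • f x) ((rankOne k hk.le).measure 1) := fun hf =>
    hf.integrable_smul hk (by fun_prop) (C := 1) fun x => by
      rw [abs_of_nonneg (by positivity), one_mul]
  have hprod : Integrable (Function.uncurry fun y x => g y * ((rankOneKernel k y x : ℂ) * f x))
      (((rankOne k hk.le).measure 1).prod ((rankOne k hk.le).measure 1)) := by
    refine (((hi hg).norm.mul_prod (hi hf).norm).const_mul C).mono' ?_
      (Filter.Eventually.of_forall fun p => ?_)
    · refine Continuous.aestronglyMeasurable ?_
      exact (hg.continuous.comp continuous_fst).mul ((Complex.continuous_ofReal.comp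
        (continuous_rankOneKernel hk)).mul (hf.continuous.comp continuous_snd))
    · simp only [Function.uncurry]
      rw [norm_mul, norm_mul, Complex.norm_real, norm_smul, norm_smul, Real.norm_eq_abs,
        Real.norm_of_nonneg (show 0 ≤ 1 + |p.1| by positivity),
        Real.norm_of_nonneg (show 0 ≤ 1 + |p.2| by positivity)]
      calc ‖g p.1‖ * (|rankOneKernel k p.1 p.2| * ‖f p.2‖)
          ≤ ‖g p.1‖ * ((C * (1 + |p.1|) * (1 + |p.2|)) * ‖f p.2‖) := by
            gcongr; exact hb _ _
        _ = _ := by ring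
  have h := integral_integral_swap hprod
  simp only [integral_const_mul] at h
  simp only [rankOneTransform]
  rw [h]
  congr 1; funext x
  rw [← integral_mul_const]
  congr 1; funext y
  rw [rankOneKernel_comm]; ring

end Kernel

/-! ### Unitary operators with the prescribed eigenvalues. -/

section Transform

variable {k : ℝ}

/-- The eigenfunction `rankOneEigen` as an element of `L²`. -/
def rankOneEigenLp (hk : 0 < k) (n s : ℕ) : Lp ℂ 2 ((rankOne k hk.le).measure 1) :=
  ((expDecay_rankOneEigen k n s).ofReal.memLp_two hk).toLp fun x => (rankOneEigen k n s x : ℂ)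

theorem inner_toLp_ofReal (hk : 0 < k) {u : ℝ → ℝ} (hu : ExpDecay u)
    (G : Lp ℂ 2 ((rankOne k hk.le).measure 1)) :
    inner ℂ ((hu.ofReal.memLp_two hk).toLp fun x => (u x : ℂ)) G =
      ∫ x, (u x : ℂ) * G x ∂(rankOne k hk.le).measure 1 := by
  rw [L2.inner_def]
  refine integral_congr_ae ?_
  filter_upwards [(hu.ofReal.memLp_two hk).coeFn_toLp] with x hx
  rw [hx, RCLike.inner_apply, Complex.conj_ofReal, mul_comm]

theorem inner_rankOneEigenLp_toLp (hk : 0 < k) (n s : ℕ) {f : ℝ → ℂ}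
    (hf : MemLp f 2 ((rankOne k hk.le).measure 1)) :
    inner ℂ (rankOneEigenLp hk n s) (hf.toLp f) =
      ∫ x, (rankOneEigen k n s x : ℂ) * f x ∂(rankOne k hk.le).measure 1 := by
  rw [rankOneEigenLp, inner_toLp_ofReal hk (expDecay_rankOneEigen k n s)]
  refine integral_congr_ae ?_
  filter_upwards [hf.coeFn_toLp] with x hx
  rw [hx]

theorem integral_rankOneEigen_mul_rankOneTransform (hk : 0 < k) {n : ℕ} (hn : n ≤ 1) (s : ℕ)
    {f : ℝ → ℂ} (hf : ExpDecay f) :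
    ∫ x, (rankOneEigen k n s x : ℂ) * rankOneTransform hk f x ∂(rankOne k hk.le).measure 1 =
      (-1) ^ (n + s) * ∫ x, (rankOneEigen k n s x : ℂ) * f x ∂(rankOne k hk.le).measure 1 := by
  rw [integral_mul_rankOneTransform hk hf (expDecay_rankOneEigen k n s).ofReal,
    ← integral_const_mul]
  congr 1; funext x
  rw [rankOneTransform_rankOneEigen hk hn, mul_assoc]

theorem neg_one_pow_ne_of_parity {m m' : ℕ} (h : Even m) (h' : ¬Even m') :
    ((-1 : ℂ) ^ m') ≠ (-1) ^ m := by
  rw [h.neg_one_pow, (Nat.not_even_iff_odd.1 h').neg_one_pow]; norm_num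

/-- Eigenvectors of a symmetric operator with the distinct eigenvalues 1 and -1 are orthogonal; no
Laguerre orthogonality relation is required. -/
theorem inner_rankOneEigenLp_eq_zero (hk : 0 < k) {n n' : ℕ} (hn : n ≤ 1) (hn' : n' ≤ 1)
    {s s' : ℕ} (h : Even (n + s)) (h' : ¬Even (n' + s')) :
    inner ℂ (rankOneEigenLp hk n s) (rankOneEigenLp hk n' s') = 0 := by
  rw [rankOneEigenLp.eq_1 hk n' s', inner_rankOneEigenLp_toLp]
  have h1 := integral_rankOneEigen_mul_rankOneTransform hk hn s
    (expDecay_rankOneEigen k n' s').ofReal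
  simp_rw [rankOneTransform_rankOneEigen hk hn', mul_left_comm _ ((-1 : ℂ) ^ _)] at h1
  rw [integral_const_mul] at h1
  exact (mul_eq_mul_right_iff.1 h1).resolve_left (neg_one_pow_ne_of_parity h h')

theorem rankOne_exp_factor (hk : 0 < k) (n s : ℕ) :
    Complex.exp (Complex.I * Real.pi / (2 * (1 : ℝ)) *
        (2 * (rankOne k hk.le).lam + (1 : ℝ))) *
      Complex.exp (Complex.I * Real.pi / (2 * (1 : ℝ)) * ((-(2 * s + 2 * n + 2 * k) : ℝ) : ℂ)) =
      (-1) ^ (n + s) := by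
  rw [← Complex.exp_add, rankOne_lam]
  have h : Complex.I * Real.pi / (2 * (1 : ℝ)) * (2 * ((k - 1 / 2 : ℝ) : ℂ) + (1 : ℝ)) +
      Complex.I * Real.pi / (2 * (1 : ℝ)) * ((-(2 * s + 2 * n + 2 * k) : ℝ) : ℂ)
      = ((n + s : ℕ) : ℂ) * (-(Real.pi * Complex.I)) := by
    push_cast; ring
  rw [h, Complex.exp_nat_mul, Complex.exp_neg, Complex.exp_pi_mul_I]
  norm_num

theorem toLp_rankOne_eigenfun (hk : 0 < k) {n : ℕ} (s : ℕ) {h : ℝ → ℂ}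
    (hh : (rankOne k hk.le).IsHarmonic n h)
    (hL : MemLp ((rankOne k hk.le).eigenfun 1 n s h) 2 ((rankOne k hk.le).measure 1)) :
    hL.toLp _ = h 1 • rankOneEigenLp hk n s := by
  rw [rankOneEigenLp, ← MemLp.toLp_const_smul]
  refine MemLp.toLp_congr _ _ (Filter.Eventually.of_forall fun x => ?_)
  rw [rankOne_eigenfun hk.le s hh]; rfl

theorem DunklDatum.IsFourierTransform.apply_rankOneEigenLp (hk : 0 < k)
    {F : Lp ℂ 2 ((rankOne k hk.le).measure 1) ≃ₗᵢ[ℂ] Lp ℂ 2 ((rankOne k hk.le).measure 1)}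
    (hF : (rankOne k hk.le).IsFourierTransform 1 F) {n : ℕ} (hn : n ≤ 1) (s : ℕ) :
    F (rankOneEigenLp hk n s) = ((-1 : ℂ) ^ (n + s)) • rankOneEigenLp hk n s := by
  have hh := rankOne_isHarmonic_pow hk.le hn
  have hfun : (rankOne k hk.le).eigenfun 1 n s (fun x => (x : ℂ) ^ n)
      = fun x => (rankOneEigen k n s x : ℂ) := funext fun x => by
    rw [rankOne_eigenfun hk.le s hh]; simp
  have hL : MemLp ((rankOne k hk.le).eigenfun 1 n s fun x => (x : ℂ) ^ n) 2
      ((rankOne k hk.le).measure 1) := by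
    rw [hfun]; exact (expDecay_rankOneEigen k n s).ofReal.memLp_two hk
  have h := hF n s _ hh _ (fun x hx => rankOne_oscillator_eigenfun hk hn s hh
    ((rankOne_regular_iff hk.le x).1 hx)) hL
  rw [toLp_rankOne_eigenfun hk s hh, rankOne_exp_factor hk] at h
  simpa using h

/-- All eigenvalues are ±1, so the operator is the reflection in the closed span of the
eigenfunctions with eigenvalue 1; those with eigenvalue -1 are orthogonal to it. -/
theorem exists_isFourierTransform (hk : 0 < k) :
    ∃ F : Lp ℂ 2 ((rankOne k hk.le).measure 1) ≃ₗᵢ[ℂ] Lp ℂ 2 ((rankOne k hk.le).measure 1),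
      (rankOne k hk.le).IsFourierTransform 1 F := by
  set S : Submodule ℂ (Lp ℂ 2 ((rankOne k hk.le).measure 1)) :=
    Submodule.span ℂ {E | ∃ n s : ℕ, n ≤ 1 ∧ Even (n + s) ∧ E = rankOneEigenLp hk n s} with hS
  set K := S.topologicalClosure with hK
  have : CompleteSpace K := S.isClosed_topologicalClosure.completeSpace_coe
  refine ⟨K.reflection, fun n s h hh c hc hL => ?_⟩
  rw [toLp_rankOne_eigenfun hk s hh, map_smul]
  rcases Nat.lt_or_ge 1 n with hn | hn
  · rw [rankOne_isHarmonic_eq_zero hk.le hn hh]; simp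
  -- The eigenvalue c is forced only if the eigenfunction is nonzero somewhere off the origin.
  -- Otherwise its class in L² is zero, and c is irrelevant.
  by_cases hex : ∃ x : ℝ, x ≠ 0 ∧ (rankOne k hk.le).eigenfun 1 n s h x ≠ 0
  · obtain ⟨x, hx, hne⟩ := hex
    have h1 := hc x ((rankOne_regular_iff hk.le x).2 hx)
    rw [rankOne_oscillator_eigenfun hk hn s hh hx] at h1
    rw [← mul_right_cancel₀ hne h1, rankOne_exp_factor hk, smul_comm]
    congr 1
    by_cases he : Even (n + s)
    · rw [he.neg_one_pow, one_smul]
      exact Submodule.reflection_mem_subspace_eq_self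
        (S.le_topologicalClosure (Submodule.subset_span ⟨n, s, hn, he, rfl⟩))
    · rw [(Nat.not_even_iff_odd.1 he).neg_one_pow, neg_one_smul]
      refine Submodule.reflection_mem_subspace_orthogonalComplement_eq_neg ?_
      rw [hK, Submodule.orthogonal_closure, hS, Submodule.mem_orthogonal]
      intro u hu
      induction hu using Submodule.span_induction with
      | mem x hx =>
        obtain ⟨n', s', hn', he', rfl⟩ := hx
        exact inner_rankOneEigenLp_eq_zero hk hn' hn he' he
      | zero => simp
      | add x y _ _ hx hy => rw [inner_add_left, hx, hy, add_zero]
      | smul a x _ hx => rw [inner_smul_left, hx, mul_zero]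
  · push Not at hex
    have h0 : h 1 • rankOneEigenLp hk n s = 0 := by
      rw [← toLp_rankOne_eigenfun hk s hh hL, Lp.eq_zero_iff_ae_eq_zero]
      filter_upwards [hL.coeFn_toLp, ae_rankOne_measure_ne_zero hk] with x hx hx0
      rw [hx, hex x hx0]; rfl
    rw [← map_smul, h0]; simp

/-- The Laguerre coefficients form a triangular matrix with nonzero diagonal, so vanishing passes
from the polynomials to the powers by strong induction. -/
theorem integral_pow_mul_eq_zero_of_rankOneEigen (hk : 0 < k) {H : ℝ → ℂ}
    (hH : ∀ u : ℝ → ℝ, ExpDecay u →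
      Integrable (fun x => (u x : ℂ) * H x) ((rankOne k hk.le).measure 1)) {n : ℕ}
    (h0 : ∀ s, ∫ x, (rankOneEigen k n s x : ℂ) * H x ∂(rankOne k hk.le).measure 1 = 0) (j : ℕ) :
    ∫ x, ((x ^ n * (|x| ^ j * Real.exp (-|x|)) : ℝ) : ℂ) * H x
      ∂(rankOne k hk.le).measure 1 = 0 := by
  induction j using Nat.strong_induction_on with
  | _ s ih =>
    have hν : -1 < 2 * k - 1 + 2 * (n : ℝ) := by
      have : (0 : ℝ) ≤ n := n.cast_nonneg
      linarith
    have h1 := h0 s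
    have h2 : ∀ x, (rankOneEigen k n s x : ℂ) * H x = ∑ j ∈ Finset.range (s + 1),
        ((laguerreCoeff s (2 * k - 1 + 2 * n) j * 2 ^ j : ℝ) : ℂ) *
          (((x ^ n * (|x| ^ j * Real.exp (-|x|)) : ℝ) : ℂ) * H x) := fun x => by
      rw [rankOneEigen_eq_sum, Complex.ofReal_sum, Finset.sum_mul]
      refine Finset.sum_congr rfl fun j _ => ?_
      rw [Complex.ofReal_mul, mul_assoc]
    simp_rw [h2] at h1
    rw [integral_finsetSum _ fun j _ =>
      (hH _ (expDecay_pow_mul_abs_pow_mul_exp n j)).const_mul _] at h1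
    simp_rw [integral_const_mul] at h1
    rw [Finset.sum_range_succ, Finset.sum_eq_zero fun j hj => by
      rw [ih j (Finset.mem_range.1 hj), mul_zero], zero_add] at h1
    refine (mul_eq_zero.1 h1).resolve_left ?_
    have := laguerreCoeff_self_ne_zero hν s
    exact Complex.ofReal_ne_zero.2 (by positivity)

theorem integral_monomial_mul_exp_eq_zero_of_rankOneEigen (hk : 0 < k) {H : ℝ → ℂ}
    (hH : ∀ u : ℝ → ℝ, ExpDecay u →
      Integrable (fun x => (u x : ℂ) * H x) ((rankOne k hk.le).measure 1))
    (h0 : ∀ n ≤ 1, ∀ s,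
      ∫ x, (rankOneEigen k n s x : ℂ) * H x ∂(rankOne k hk.le).measure 1 = 0) (m : ℕ) :
    ∫ x, ((x ^ m * Real.exp (-|x|) : ℝ) : ℂ) * H x ∂(rankOne k hk.le).measure 1 = 0 := by
  -- Even powers are |x|^m with n = 0; an odd power 2i+1 is x|x|^{2i} with n = 1.
  rcases Nat.even_or_odd m with hm | ⟨i, rfl⟩
  · have h := integral_pow_mul_eq_zero_of_rankOneEigen hk hH (h0 0 zero_le_one) m
    simp only [pow_zero, one_mul, hm.pow_abs] at h
    exact h
  · have h := integral_pow_mul_eq_zero_of_rankOneEigen hk hH (h0 1 le_rfl) (2 * i)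
    simp only [pow_one, (even_two_mul i).pow_abs, ← mul_assoc, ← pow_succ'] at h
    exact h

/-- Completeness of the eigenfunctions. -/
theorem ae_eq_zero_of_integral_rankOneEigen_mul (hk : 0 < k) {H : ℝ → ℂ}
    (hH : ∀ u : ℝ → ℝ, ExpDecay u →
      Integrable (fun x => (u x : ℂ) * H x) ((rankOne k hk.le).measure 1))
    (h0 : ∀ n ≤ 1, ∀ s,
      ∫ x, (rankOneEigen k n s x : ℂ) * H x ∂(rankOne k hk.le).measure 1 = 0) :
    H =ᵐ[(rankOne k hk.le).measure 1] 0 := by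
  have hexp : ExpDecay fun x : ℝ => Real.exp (-(|x| / 2)) :=
    ⟨by fun_prop, 1, zero_le_one, fun x => by
      rw [Real.norm_of_nonneg (Real.exp_pos _).le, one_mul]
      apply le_of_eq; congr 1; ring⟩
  have hmon : ∀ m : ℕ, ExpDecay fun x : ℝ => x ^ m * Real.exp (-|x|) := fun m => by
    simpa using expDecay_pow_mul_abs_pow_mul_exp m 0
  have hmom := integral_monomial_mul_exp_eq_zero_of_rankOneEigen hk hH h0
  have hre : (fun x => (H x).re) =ᵐ[(rankOne k hk.le).measure 1] 0 := by
    refine ae_eq_zero_of_integral_mul_pow_mul_exp_eq_zero ?_ fun m => ?_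
    · refine (hH _ hexp).re.congr (Filter.Eventually.of_forall fun x => ?_)
      change Complex.re (((_ : ℝ) : ℂ) * H x) = _
      rw [Complex.re_ofReal_mul, mul_comm]
    · have h := Complex.reCLM.integral_comp_comm (hH _ (hmon m))
      rw [hmom m, map_zero] at h
      refine Eq.trans ?_ h
      congr 1; funext x
      rw [Complex.reCLM_apply, Complex.re_ofReal_mul, mul_comm]
  have him : (fun x => (H x).im) =ᵐ[(rankOne k hk.le).measure 1] 0 := by
    refine ae_eq_zero_of_integral_mul_pow_mul_exp_eq_zero ?_ fun m => ?_
    · refine (hH _ hexp).im.congr (Filter.Eventually.of_forall fun x => ?_)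
      change Complex.im (((_ : ℝ) : ℂ) * H x) = _
      rw [Complex.im_ofReal_mul, mul_comm]
    · have h := Complex.imCLM.integral_comp_comm (hH _ (hmon m))
      rw [hmom m, map_zero] at h
      refine Eq.trans ?_ h
      congr 1; funext x
      rw [Complex.imCLM_apply, Complex.im_ofReal_mul, mul_comm]
  filter_upwards [hre, him] with x h1 h2
  exact Complex.ext h1 h2

/-- Every unitary operator with the prescribed eigenfunctions is the integral transform. -/
theorem DunklDatum.IsFourierTransform.ae_eq_rankOneTransform (hk : 0 < k)
    {F : Lp ℂ 2 ((rankOne k hk.le).measure 1) ≃ₗᵢ[ℂ] Lp ℂ 2 ((rankOne k hk.le).measure 1)}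
    (hF : (rankOne k hk.le).IsFourierTransform 1 F) {f : ℝ → ℂ} (hf : ExpDecay f)
    (hL : MemLp f 2 ((rankOne k hk.le).measure 1)) :
    F (hL.toLp f) =ᵐ[(rankOne k hk.le).measure 1] rankOneTransform hk f := by
  set g := F (hL.toLp f) with hg
  have h1 : ∀ u : ℝ → ℝ, ExpDecay u →
      Integrable (fun x => (u x : ℂ) * g x) ((rankOne k hk.le).measure 1) := fun u hu =>
    (hu.ofReal.memLp_two hk).integrable_mul (Lp.memLp g)
  have h2 : ∀ u : ℝ → ℝ, ExpDecay u → Integrable (fun x => (u x : ℂ) * rankOneTransform hk f x)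
      ((rankOne k hk.le).measure 1) := fun u hu =>
    hf.integrable_mul_rankOneTransform hk hu.ofReal
  have h := ae_eq_zero_of_integral_rankOneEigen_mul hk (H := fun x => g x - rankOneTransform hk f x)
    (fun u hu => by simp only [mul_sub]; exact (h1 u hu).sub (h2 u hu)) fun n hn s => by
      have he := expDecay_rankOneEigen k n s
      have hF' := hF.apply_rankOneEigenLp hk hn s
      simp only [mul_sub]
      rw [integral_sub (h1 _ he) (h2 _ he), integral_rankOneEigen_mul_rankOneTransform hk hn s hf,
        ← inner_toLp_ofReal hk he, ← inner_rankOneEigenLp_toLp hk n s hL, sub_eq_zero, hg]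
      -- Unitarity moves F onto the eigenfunction: the pairing with F f is (-1)^(n+s) times the
      -- pairing with f, just as for the integral transform. Completeness finishes.
      have h3 := F.inner_map_map (rankOneEigenLp hk n s) (hL.toLp f)
      rw [hF', inner_smul_left] at h3
      rw [← h3]
      have h4 : (-1 : ℂ) ^ (n + s) * (-1) ^ (n + s) = 1 := by
        rw [← mul_pow]; norm_num
      simp only [map_pow, map_neg, map_one]
      rw [← mul_assoc, h4, one_mul]; rfl
  filter_upwards [h] with x hx
  exact sub_eq_zero.1 hx

end Transform

/-! ### Existence and uniqueness of the kernel. -/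

section Uniqueness

variable {k : ℝ}

theorem rankOne_isKernel (hk : 0 < k) :
    (rankOne k hk.le).IsKernel 1 fun x y => (rankOneKernel k x y : ℂ) := by
  refine ⟨Complex.continuous_ofReal.comp (continuous_rankOneKernel hk), ?_⟩
  obtain ⟨F, hF⟩ := exists_isFourierTransform hk
  refine ⟨F, hF, fun f hf hs => ?_⟩
  have he := expDecay_of_hasCompactSupport hf hs
  exact ⟨he.memLp_two hk, hF.ae_eq_rankOneTransform hk he _⟩

/-- A continuous function that integrates to zero against continuous compactly supported functions
vanishes. -/
theorem eq_zero_of_integral_mul_hasCompactSupport {μ : Measure ℝ} [IsFiniteMeasureOnCompacts μ]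
    [μ.IsOpenPosMeasure] {D : ℝ → ℂ} (hD : Continuous D)
    (h : ∀ f : ℝ → ℂ, Continuous f → HasCompactSupport f → ∫ x, D x * f x ∂μ = 0) (x : ℝ) :
    D x = 0 := by
  by_contra hx
  obtain ⟨b, hb1, -, hbs, hb01⟩ := exists_continuous_one_zero_of_isCompact
    (isCompact_singleton (x := x)) (t := ∅) isClosed_empty (by simp)
  have hcs : HasCompactSupport fun y => ‖D y‖ ^ 2 * b y := hbs.mul_left
  have hpos := Continuous.integral_pos_of_hasCompactSupport_nonneg_nonzero (μ := μ)
    (f := fun y => ‖D y‖ ^ 2 * b y) (by fun_prop) hcs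
    (fun y => mul_nonneg (by positivity) (hb01 y).1) (x := x) (by
      have : b x = 1 := hb1 rfl
      simp [this, hx])
  -- Testing with the conjugate of D times a bump at x gives the integral of |D|² times the bump,
  -- which is positive if D x ≠ 0.
  have h1 := h (fun y => (starRingEnd ℂ) (D y) * (b y : ℂ))
    (by fun_prop) (HasCompactSupport.mul_left (hbs.comp_left (g := Complex.ofReal) rfl))
  have h2 : ∀ y, D y * ((starRingEnd ℂ) (D y) * (b y : ℂ)) = ((‖D y‖ ^ 2 * b y : ℝ) : ℂ) := by
    intro y
    rw [← mul_assoc, Complex.mul_conj, Complex.normSq_eq_norm_sq]; push_cast; ring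
  simp_rw [h2] at h1
  rw [integral_complex_ofReal] at h1
  exact hpos.ne' (by exact_mod_cast h1)

theorem continuous_integral_mul_hasCompactSupport {μ : Measure ℝ} [IsFiniteMeasureOnCompacts μ]
    {B : ℝ → ℝ → ℂ} (hB : Continuous fun p : ℝ × ℝ => B p.1 p.2) {f : ℝ → ℂ} (hf : Continuous f)
    (hs : HasCompactSupport f) : Continuous fun y => ∫ x, B y x * f x ∂μ := by
  have h := continuous_parametric_integral_of_continuous (μ := μ) (f := fun y x => B y x * f x)
    (by exact hB.mul (hf.comp continuous_snd)) hs
  convert h using 2 with y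
  refine (setIntegral_eq_integral_of_forall_compl_eq_zero fun x hx => ?_).symm
  rw [image_eq_zero_of_notMem_tsupport hx, mul_zero]

theorem DunklDatum.IsKernel.eq_rankOneKernel (hk : 0 < k) {B : ℝ → ℝ → ℂ}
    (hB : (rankOne k hk.le).IsKernel 1 B) (y x : ℝ) : B y x = (rankOneKernel k y x : ℂ) := by
  have := isFiniteMeasureOnCompacts_rankOne_measure hk
  have := isOpenPosMeasure_rankOne_measure hk
  obtain ⟨hBc, F, hF, hFB⟩ := hB
  have hB0 : Continuous fun p : ℝ × ℝ => (rankOneKernel k p.1 p.2 : ℂ) :=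
    Complex.continuous_ofReal.comp (continuous_rankOneKernel hk)
  -- For fixed f both integrals are continuous in y, and the measure charges every nonempty open
  -- set, so equality almost everywhere becomes equality for every y. Only then is f varied with y
  -- fixed.
  have key : ∀ f : ℝ → ℂ, Continuous f → HasCompactSupport f → ∀ y,
      ∫ x, B y x * f x ∂(rankOne k hk.le).measure 1 =
        ∫ x, (rankOneKernel k y x : ℂ) * f x ∂(rankOne k hk.le).measure 1 := by
    intro f hf hs
    obtain ⟨hL, hae⟩ := hFB f hf hs
    have h1 := hF.ae_eq_rankOneTransform hk (expDecay_of_hasCompactSupport hf hs) hL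
    refine congrFun (Continuous.ae_eq_iff_eq ((rankOne k hk.le).measure 1)
      (continuous_integral_mul_hasCompactSupport hBc hf hs)
      (continuous_integral_mul_hasCompactSupport hB0 hf hs) |>.1 ?_)
    filter_upwards [hae, h1] with y h2 h3
    rw [← h2, h3, rankOneTransform]
  have hy : Continuous fun x => B y x := hBc.comp (continuous_const.prodMk continuous_id)
  have hy0 : Continuous fun x => (rankOneKernel k y x : ℂ) :=
    hB0.comp (continuous_const.prodMk continuous_id)
  refine sub_eq_zero.1 (eq_zero_of_integral_mul_hasCompactSupport
    (μ := (rankOne k hk.le).measure 1) (hy.sub hy0) (fun f hf hs => ?_) x)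
  refine Eq.trans (integral_congr_ae (Filter.Eventually.of_forall fun x => sub_mul _ _ _)) ?_
  refine (integral_sub ((hy.mul hf).integrable_of_hasCompactSupport hs.mul_left)
    ((hy0.mul hf).integrable_of_hasCompactSupport hs.mul_left)).trans ?_
  exact sub_eq_zero.2 (key f hf hs y)

theorem rankOne_existsUnique_isKernel (hk : 0 < k) :
    ∃! B : ℝ → ℝ → ℂ, (rankOne k hk.le).IsKernel 1 B :=
  ⟨_, rankOne_isKernel hk, fun _ hB => funext₂ (hB.eq_rankOneKernel hk)⟩

end Uniqueness

/-! ### The elementary kernel at k = 1/4 and its maximum. -/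

section Quarter

/-- The profile of the kernel `B_{1/4,1}` on `xy > 0`. -/
def quarterProfile (t : ℝ) : ℝ := 2 * Real.cos t - Real.sinc t

theorem Gamma_mul_besselClifford_one_half {z : ℝ} (hz : 0 ≤ z) :
    Real.Gamma (1 / 2) * besselClifford (1 / 2) z = Real.cos (2 * √z) := by
  have h := besselClifford_one_half (t := 2 * √z)
  have hπ := (Real.sqrt_pos.2 Real.pi_pos).ne'
  rw [mul_pow, Real.sq_sqrt hz, show (2 : ℝ) ^ 2 * z / 4 = z by ring] at h
  rw [h, Real.Gamma_one_half_eq]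
  field_simp

theorem Gamma_mul_besselClifford_five_half {z : ℝ} (hz : 0 ≤ z) :
    Real.Gamma (1 / 2) * (z * besselClifford (1 / 2 + 2) z) =
      Real.sinc (2 * √z) - Real.cos (2 * √z) := by
  rcases hz.eq_or_lt with rfl | hz0
  · simp
  have ht : 2 * √z ≠ 0 := by
    have := Real.sqrt_pos.2 hz0
    positivity
  have h := besselClifford_three_half ht
  have hπ := (Real.sqrt_pos.2 Real.pi_pos).ne'
  rw [mul_pow, Real.sq_sqrt hz, show (2 : ℝ) ^ 2 * z / 4 = z by ring] at h
  have hr := besselClifford_recurrence (show (0 : ℝ) < 1 / 2 by norm_num) z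
  rw [show (1 / 2 + 1 : ℝ) = 3 / 2 by norm_num, h] at hr
  have h1 := Gamma_mul_besselClifford_one_half hz
  rw [Real.sinc_of_ne_zero ht, ← h1, hr, Real.Gamma_one_half_eq]
  field_simp
  ring

theorem rankOneKernel_quarter_of_nonneg {x y : ℝ} (h : 0 ≤ x * y) :
    rankOneKernel (1 / 4) x y = quarterProfile (2 * √|x * y|) := by
  have h1 := Gamma_mul_besselClifford_one_half (abs_nonneg (x * y))
  have h2 := Gamma_mul_besselClifford_five_half (abs_nonneg (x * y))
  rw [rankOneKernel, quarterProfile, show (2 * (1 / 4) : ℝ) = 1 / 2 by norm_num]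
  rw [abs_of_nonneg h] at h1 h2 ⊢
  linear_combination h1 - h2

theorem rankOneKernel_quarter_of_nonpos {x y : ℝ} (h : x * y ≤ 0) :
    rankOneKernel (1 / 4) x y = Real.sinc (2 * √|x * y|) := by
  have h1 := Gamma_mul_besselClifford_one_half (abs_nonneg (x * y))
  have h2 := Gamma_mul_besselClifford_five_half (abs_nonneg (x * y))
  rw [rankOneKernel, show (2 * (1 / 4) : ℝ) = 1 / 2 by norm_num]
  rw [abs_of_nonpos h] at h1 h2 ⊢
  linear_combination h1 + h2

theorem continuous_quarterProfile : Continuous quarterProfile := by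
  have := Real.continuous_sinc
  unfold quarterProfile
  fun_prop

theorem quarterProfile_sq_le {t : ℝ} (ht : 0 < t) : quarterProfile t ^ 2 ≤ 4 + 1 / t ^ 2 := by
  rw [quarterProfile, Real.sinc_of_ne_zero ht.ne']
  have h1 := Real.sin_sq_add_cos_sq t
  -- The Cauchy–Schwarz bound for the vectors (2, -1/t) and (cos t, sin t), with its defect written
  -- out.
  have h2 : 4 + 1 / t ^ 2 - (2 * Real.cos t - Real.sin t / t) ^ 2
      = (2 * Real.sin t + Real.cos t / t) ^ 2 := by
    field_simp
    linear_combination (-(4 * t ^ 2 + 1)) * h1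
  nlinarith [sq_nonneg (2 * Real.sin t + Real.cos t / t)]

theorem abs_quarterProfile_le_of_four_le {t : ℝ} (ht : 4 ≤ t) : |quarterProfile t| ≤ 2.02 := by
  refine abs_le_of_sq_le_sq ((quarterProfile_sq_le (by linarith)).trans ?_) (by norm_num)
  have : 1 / t ^ 2 ≤ 1 / 4 ^ 2 := by gcongr
  norm_num at this ⊢
  linarith

theorem neg_quarterProfile_pi_sub_le {u : ℝ} (hu : 0.44 ≤ u) (hu' : u ≤ Real.pi / 2) :
    -quarterProfile (Real.pi - u) ≤ 2.034 := by
  have hπ := Real.pi_gt_d2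
  have hπ' := Real.pi_lt_d2
  have hpos : 0 < Real.pi - u := by linarith
  rw [quarterProfile, Real.sinc_of_ne_zero hpos.ne', Real.cos_pi_sub, Real.sin_pi_sub]
  rcases le_or_gt u 1 with h1 | h1
  · have hc := (abs_le.1 (Real.cos_bound (x := u) (by rw [abs_of_nonneg] <;> linarith))).2
    rw [abs_of_nonneg (by linarith)] at hc
    have hs : Real.sin u / (Real.pi - u) ≤ u / (3.14 - u) := by
      have := Real.sin_le (show 0 ≤ u by linarith)
      have h2 : (0 : ℝ) < 3.14 - u := by linarith
      gcongr
    have h4 : u ^ 4 ≤ u ^ 2 := pow_le_pow_of_le_one (by linarith) h1 (by norm_num)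
    -- The coefficient 0.89 is below 1 - 5/48, what remains of the quadratic term in the Taylor
    -- bound for 2 cos u once u⁴ ≤ u² is used; 0.034 is the excess over 2 that is allowed.
    have h5 : u / (3.14 - u) ≤ 0.034 + 0.89 * u ^ 2 := by
      rw [div_le_iff₀ (by linarith)]
      nlinarith [mul_nonneg (sub_nonneg.2 hu) (sub_nonneg.2 h1),
        mul_nonneg (mul_nonneg (sub_nonneg.2 hu) (sub_nonneg.2 h1)) (sub_nonneg.2 hu)]
    nlinarith
  · have hc := (abs_le.1 (Real.cos_bound (x := 1) (by simp))).2
    have hc' : Real.cos u ≤ Real.cos 1 :=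
      Real.cos_le_cos_of_nonneg_of_le_pi (by norm_num) (by linarith) h1.le
    have hs : Real.sin u / (Real.pi - u) ≤ 1 / 1.5 := by
      have := Real.sin_le_one u
      gcongr
      linarith
    norm_num at hc hs
    linarith

theorem abs_quarterProfile_le {t : ℝ} (ht : 0 ≤ t) : |quarterProfile t| ≤ 2.0345 := by
  have hπ := Real.pi_gt_d2
  have hπ' := Real.pi_lt_d2
  -- From 2.7 on, 4 + 1/t² is already below 2.0345². Below it, π - t ≥ 0.44 keeps away from the
  -- minimum of the profile.
  rcases le_or_gt t 2.7 with h | h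
  · have hs : 0 ≤ Real.sinc t := by
      rw [Real.sinc]
      split_ifs
      · norm_num
      · exact div_nonneg (Real.sin_nonneg_of_nonneg_of_le_pi ht (by linarith)) ht
    rw [abs_le]
    constructor
    · rcases le_or_gt t (Real.pi / 2) with h2 | h2
      · have := Real.cos_nonneg_of_neg_pi_div_two_le_of_le (by linarith) h2
        have := Real.sinc_le_one t
        rw [quarterProfile]; linarith
      · have := neg_quarterProfile_pi_sub_le (u := Real.pi - t) (by linarith) (by linarith)
        rw [sub_sub_cancel] at this
        linarith
    · have := Real.cos_le_one t
      rw [quarterProfile]; linarith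
  · refine abs_le_of_sq_le_sq ((quarterProfile_sq_le (by linarith)).trans ?_) (by norm_num)
    have : 1 / t ^ 2 ≤ 1 / 2.7 ^ 2 := by gcongr
    norm_num at this ⊢
    linarith

/-- At π - u the negated profile is about 2 - u² + u/π for small u, largest near u = 1/(2π) ≈ 0.16.
-/
theorem lt_abs_quarterProfile : 2.026 < |quarterProfile (Real.pi - 0.16)| := by
  have hπ := Real.pi_gt_d2
  have hπ' := Real.pi_lt_d2
  rw [quarterProfile, Real.sinc_of_ne_zero (by linarith), Real.cos_pi_sub, Real.sin_pi_sub]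
  have hc := Real.one_sub_sq_div_two_le_cos (x := 0.16)
  have hs := Real.sin_gt_sub_cube (x := 0.16) (by norm_num)
  have h : 0.053 ≤ Real.sin 0.16 / (Real.pi - 0.16) := by
    rw [le_div_iff₀ (by linarith)]
    norm_num at hs ⊢
    linarith
  rw [lt_abs]
  right
  norm_num at hc ⊢
  linarith

theorem exists_isGreatest_quarter : ∃ M : ℝ,
    IsGreatest (Set.range fun p : ℝ × ℝ => |rankOneKernel (1 / 4) p.1 p.2|) M ∧
      |M - 2.03| < 0.005 := by
  have hπ := Real.pi_gt_d2
  have hπ' := Real.pi_lt_d2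
  obtain ⟨t, ht, hmax⟩ := isCompact_Icc.exists_isMaxOn (s := Set.Icc (0 : ℝ) 4) ⟨0, by simp⟩
    continuous_quarterProfile.abs.continuousOn
  have h1 : 2.026 < |quarterProfile t| :=
    lt_of_lt_of_le lt_abs_quarterProfile (hmax ⟨by linarith, by linarith⟩)
  -- At the point (t²/4, 1) the variable 2√|xy| equals t. Beyond 4 the profile stays below 2.02, and
  -- for xy ≤ 0 the kernel is a sinc, bounded by 1.
  refine ⟨|quarterProfile t|, ⟨⟨(t ^ 2 / 4, 1), ?_⟩, ?_⟩, ?_⟩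
  · have h2 : 2 * √|t ^ 2 / 4 * 1| = t := by
      rw [mul_one, abs_of_nonneg (by positivity), show t ^ 2 / 4 = (t / 2) ^ 2 by ring,
        Real.sqrt_sq (by linarith [ht.1])]
      ring
    simp only
    rw [rankOneKernel_quarter_of_nonneg (by positivity), h2]
  · rintro _ ⟨⟨x, y⟩, rfl⟩
    simp only
    rcases le_total 0 (x * y) with h | h
    · rw [rankOneKernel_quarter_of_nonneg h]
      rcases le_total (2 * √|x * y|) 4 with h4 | h4
      · exact hmax ⟨by positivity, h4⟩
      · linarith [abs_quarterProfile_le_of_four_le h4]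
    · rw [rankOneKernel_quarter_of_nonpos h]
      linarith [Real.abs_sinc_le_one (2 * √|x * y|)]
  · have h2 := abs_quarterProfile_le ht.1
    rw [abs_lt]
    constructor <;> norm_num at h1 h2 ⊢ <;> linarith

end Quarter

/-! ### Unboundedness of the kernel and the main theorem. -/

theorem exists_lt_abs_rankOneKernel {k : ℝ} (hk : 0 < k) (hk' : k < 1 / 4) (M : ℝ) :
    ∃ x y : ℝ, 0 < x * y ∧ M < |rankOneKernel k x y| := by
  have hΓ := Real.Gamma_pos_of_pos (show 0 < 2 * k by positivity)
  obtain ⟨z, hz, h⟩ := besselClifford_sub_unbounded (β := 2 * k) (by positivity) (by linarith)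
    (M / Real.Gamma (2 * k))
  refine ⟨z, 1, by simpa using hz, ?_⟩
  rw [div_lt_iff₀ hΓ] at h
  rw [rankOneKernel, mul_one, abs_of_pos hz, abs_mul, abs_of_pos hΓ, mul_comm]
  exact h

end KAFourier

end

theorem mainTheorem9 :
    -- the inequality `|B_{k,a}(x,y)| ≤ B_{k,a}(0,y) = 1` can fail although `2⟨k⟩ + d + a > 2`
    (∃ (k : ℝ) (hk : 0 ≤ k) (a : ℝ), 0 < a ∧
      2 * (KAFourier.rankOne k hk).index + (Module.finrank ℝ ℝ : ℝ) + a > 2 ∧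
      (∃! B : ℝ → ℝ → ℂ, (KAFourier.rankOne k hk).IsKernel a B) ∧
      ∀ B : ℝ → ℝ → ℂ, (KAFourier.rankOne k hk).IsKernel a B →
        (∀ y, B 0 y = 1) ∧ ¬ ∀ x y, ‖B x y‖ ≤ 1) ∧
    -- `d = 1`, `a = 1`, `0 < k < 1/4`: the kernel is unbounded
    (∀ (k : ℝ) (hk : 0 < k), k < 1 / 4 →
      2 * (KAFourier.rankOne k hk.le).index + (Module.finrank ℝ ℝ : ℝ) + 1 > 2 ∧
      (∃! B : ℝ → ℝ → ℂ, (KAFourier.rankOne k hk.le).IsKernel 1 B) ∧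
      ∀ B : ℝ → ℝ → ℂ, (KAFourier.rankOne k hk.le).IsKernel 1 B →
        (∀ y, B 0 y = 1) ∧ ∀ M : ℝ, ∃ x y : ℝ, 0 < x * y ∧ M < ‖B x y‖) ∧
    -- `d = 1`, `a = 1`, `k = 1/4`: the kernel in closed form, and its maximum modulus
    (∀ (k : ℝ) (hk : 0 ≤ k), k = 1 / 4 →
      2 * (KAFourier.rankOne k hk).index + (Module.finrank ℝ ℝ : ℝ) + 1 > 2 ∧
      (∃! B : ℝ → ℝ → ℂ, (KAFourier.rankOne k hk).IsKernel 1 B) ∧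
      ∀ B : ℝ → ℝ → ℂ, (KAFourier.rankOne k hk).IsKernel 1 B →
        (∀ y, B 0 y = 1) ∧
        (∀ x y t : ℝ, 0 < x * y → t = 2 * Real.sqrt |x * y| →
          B x y = ((2 * Real.cos t - Real.sin t / t : ℝ) : ℂ)) ∧
        ∃ M : ℝ, IsGreatest (Set.range fun p : ℝ × ℝ => ‖B p.1 p.2‖) M ∧
          |M - 2.03| < 0.005) := by
  have hcond : ∀ (k : ℝ) (hk : 0 < k),
      2 * (KAFourier.rankOne k hk.le).index + (Module.finrank ℝ ℝ : ℝ) + 1 > 2 := by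
    intro k hk
    rw [KAFourier.rankOne_index, Module.finrank_self]
    push_cast
    linarith
  have hzero : ∀ (k : ℝ) (hk : 0 < k) (B : ℝ → ℝ → ℂ),
      (KAFourier.rankOne k hk.le).IsKernel 1 B → ∀ y, B 0 y = 1 := by
    intro k hk B hB y
    rw [hB.eq_rankOneKernel hk, KAFourier.rankOneKernel_zero hk, Complex.ofReal_one]
  have hq : (0 : ℝ) < 1 / 4 := by norm_num
  -- The failure of the inequality is witnessed by k = 1/4 and a = 1, where the maximum exceeds
  -- 2.025.
  refine ⟨⟨1 / 4, hq.le, 1, one_pos, hcond _ hq, KAFourier.rankOne_existsUnique_isKernel hq,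
    fun B hB => ⟨hzero _ hq B hB, fun hle => ?_⟩⟩, fun k hk hk' => ⟨hcond k hk,
    KAFourier.rankOne_existsUnique_isKernel hk, fun B hB => ⟨hzero k hk B hB, fun M => ?_⟩⟩, ?_⟩
  · obtain ⟨M, ⟨⟨p, rfl⟩, -⟩, hM⟩ := KAFourier.exists_isGreatest_quarter
    have h := hle p.1 p.2
    rw [hB.eq_rankOneKernel hq, Complex.norm_real, Real.norm_eq_abs] at h
    have h2 := (abs_lt.1 hM).1
    norm_num at h2 h
    linarith
  · obtain ⟨x, y, hxy, h⟩ := KAFourier.exists_lt_abs_rankOneKernel hk hk' M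
    refine ⟨x, y, hxy, ?_⟩
    rwa [hB.eq_rankOneKernel hk, Complex.norm_real, Real.norm_eq_abs]
  · rintro k hk rfl
    refine ⟨hcond _ hq, KAFourier.rankOne_existsUnique_isKernel hq,
      fun B hB => ⟨hzero _ hq B hB, fun x y t hxy ht => ?_, ?_⟩⟩
    · have ht0 : t ≠ 0 := by
        have := Real.sqrt_pos.2 (abs_pos.2 hxy.ne')
        rw [ht]; positivity
      rw [KAFourier.DunklDatum.IsKernel.eq_rankOneKernel hq hB,
        KAFourier.rankOneKernel_quarter_of_nonneg hxy.le, ← ht, KAFourier.quarterProfile,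
        Real.sinc_of_ne_zero ht0]
    · obtain ⟨M, hM, hM'⟩ := KAFourier.exists_isGreatest_quarter
      refine ⟨M, ?_, hM'⟩
      have hB' := KAFourier.DunklDatum.IsKernel.eq_rankOneKernel hq hB
      simpa only [hB', Complex.norm_real, Real.norm_eq_abs] using hM
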